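/- Let $N\ge 2$ and let $M\subset\mathbb R^{2N}$ be an embedded $N$-dimensional submanifold of class $C^3$, with tangent bundle $TM\subset\mathbb R^{2N}\times\mathbb R^{2N}$ and with the Euclidean norm $\|\cdot\|$ on tangent vectors. Let $F:TM\to\mathbb R$ be a Finsler metric: $F$ is continuous on $TM$ and $C^3$ off the zero section, $F(q,\lambda v)=\lambda F(q,v)$ for $\lambda>0$, $F(q,v)>0$ for $v\neq0$, and for all $q\in M$ and $v\in T_qM\setminus\{0\}$ the form $g_v(\xi,\eta)=\frac12\frac{\partial^2}{\partial s\,\partial t}F^2(q,v+s\xi+t\eta)\big|_{s=t=0}$ on $T_qM$ is positive definite. Put $G=F^2$. Let $\Phi:M\to\mathbb R$ be of class $C^2$, put $\Omega=\{\Phi<0\}$, $\partial\Omega=\{\Phi=0\}$, $\overline\Omega=\{\Phi\le0\}$, and assume that $d\Phi(q)\ne0$ for every $q\in\partial\Omega$ and that $\overline\Omega$ is compact and homeomorphic to the closed unit disk of $\mathbb R^N$. Let $$\mathfrak M=\{x\in H^{1,2}([0,1],\mathbb R^{2N}):\ x(s)\in\overline\Omega\ \text{for all } s\in[0,1],\ x(0),x(1)\in\partial\Omega\},\qquad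 \mathcal J(x)=\frac12\int_0^1G(x,\dot x)\,ds,$$ and for $x\in\mathfrak M$ let $\mathcal V^-(x)$ be the set of all $\xi\in H^{1,2}([0,1],\mathbb R^{2N})$ such that $\xi(s)\in T_{x(s)}M$ for all $s\in[0,1]$, $d\Phi(x(0))[\xi(0)]=d\Phi(x(1))[\xi(1)]=0$, and $d\Phi(x(s))[\xi(s)]\le0$ for all $s\in(0,1)$ with $x(s)\in\partial\Omega$. For such $\xi$ let $$d\mathcal J(x)[\xi]=\frac12\int_0^1\big(d_qG(x,\dot x)[\xi]+d_vG(x,\dot x)[\dot\xi]\big)\,ds,\qquad \|\xi\|_*=\max\{\|\xi(0)\|,\|\xi(1)\|\}+\Big(\int_0^1\|\dot\xi\|^2ds\Big)^{1/2},$$ where the first integrand is the differential of $G:TM\to\mathbb R$ at $(x,\dot x)$ applied to the vector $(\xi,\dot\xi)$, tangent to $TM$ for a.e. $s$. Let $c\in\mathbb R$ and let $(x_n)_n\subset\mathfrak M$ be a $\mathcal V^-$-Palais–Smale sequence for $\mathcal J$ at level $c$: $\mathcal J(x_n)\to c$, and there are $\epsilon_n\to0^+$ such that $d\mathcal J(x_n)[V]\ge-\epsilon_n$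 for all $n$ and all $V\in\mathcal V^-(x_n)$ with $\|V\|_*=1$. Then $(x_n)_n$ has a subsequence that converges strongly in $H^{1,2}([0,1],\mathbb R^{2N})$ to an element of $\mathfrak M$. -/

import Mathlib

open Set Filter Topology MeasureTheory

namespace FinslerChord

noncomputable section

/-- `M` is an embedded submanifold of dimension `n` and class `C^k` of `E`: around each of its
points some `C^k` diffeomorphism between open subsets of `E` carries `M` to a linear subspace of
dimension `n`. -/
def IsSubmanifold {E : Type*} [NormedAddCommGroup E] [NormedSpace ℝ E]
    (k : WithTop ℕ∞) (n : ℕ) (M : Set E) : Prop :=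
  ∀ p ∈ M, ∃ (e : OpenPartialHomeomorph E E) (W : Submodule ℝ E),
    p ∈ e.source ∧ Module.finrank ℝ W = n ∧
    ContDiffOn ℝ k e e.source ∧ ContDiffOn ℝ k e.symm e.target ∧
    e.source ∩ M = e.source ∩ e ⁻¹' (W : Set E)

/-- The tangent space `T_q M`: velocities at `q` of curves lying in `M`. -/
def tangentSpace {E : Type*} [NormedAddCommGroup E] [NormedSpace ℝ E]
    (M : Set E) (q : E) : Set E :=
  {v | ∃ c : ℝ → E, c 0 = q ∧ HasDerivAt c v 0 ∧ ∀ᶠ t in 𝓝 (0 : ℝ), c t ∈ M}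

/-- The tangent bundle `TM` as a subset of `E × E`. -/
def tangentBundle {E : Type*} [NormedAddCommGroup E] [NormedSpace ℝ E] (M : Set E) :
    Set (E × E) :=
  {p | p.1 ∈ M ∧ p.2 ∈ tangentSpace M p.1}

/-- The differential of `f : M → ℝ` at `q`, applied to `v`. Derivatives within `M` are unique
only on tangent vectors of `M`, and it is only applied to these
(see `differential_apply_eq_deriv`). -/
def differential {E : Type*} [NormedAddCommGroup E] [NormedSpace ℝ E]
    (M : Set E) (f : E → ℝ) (q v : E) : ℝ :=
  fderivWithin ℝ f M q v

/-- On tangent vectors of `M`, the differential is the derivative along any curve of `M`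
representing the vector; it depends on the values of `f` on `M` only. -/
theorem differential_apply_eq_deriv {E : Type*} [NormedAddCommGroup E] [NormedSpace ℝ E]
    {M : Set E} {f : E → ℝ} {q v : E} {c : ℝ → E} (hf : DifferentiableWithinAt ℝ f M q)
    (hc0 : c 0 = q) (hc : HasDerivAt c v 0) (hM : ∀ᶠ t in 𝓝 (0 : ℝ), c t ∈ M) :
    differential M f q v = deriv (fun t => f (c t)) 0 := by
  have h1 : HasFDerivWithinAt f (fderivWithin ℝ f M q) M (c 0) := by
    rw [hc0]; exact hf.hasFDerivWithinAt
  have h2 : HasDerivWithinAt (fun t => f (c t)) (fderivWithin ℝ f M q v) {t | c t ∈ M} 0 :=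
    h1.comp_hasDerivWithinAt 0 hc.hasDerivWithinAt (fun t ht => ht)
  exact (h2.hasDerivAt hM).deriv.symm

/-- The fundamental tensor
`g_v(ξ, η) = ½ ∂²/∂s∂t [F²(q, v + s ξ + t η)]` at `s = t = 0`. -/
def fundamentalTensor {E : Type*} [NormedAddCommGroup E] [NormedSpace ℝ E]
    (F : E × E → ℝ) (q v ξ η : E) : ℝ :=
  (1 / 2) * deriv (fun s : ℝ => deriv (fun t : ℝ => F (q, v + s • ξ + t • η) ^ 2) 0) 0

/-- `F` (only its values on `TM` matter) is a Finsler metric on `M`. -/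
structure IsFinslerMetric {E : Type*} [NormedAddCommGroup E] [NormedSpace ℝ E]
    (M : Set E) (F : E × E → ℝ) : Prop where
  continuousOn : ContinuousOn F (tangentBundle M)
  contDiffOn : ContDiffOn ℝ 3 F {p | p ∈ tangentBundle M ∧ p.2 ≠ 0}
  homogeneous : ∀ q ∈ M, ∀ v ∈ tangentSpace M q, ∀ a : ℝ, 0 < a → F (q, a • v) = a * F (q, v)
  pos : ∀ q ∈ M, ∀ v ∈ tangentSpace M q, v ≠ 0 → 0 < F (q, v)
  posDef : ∀ q ∈ M, ∀ v ∈ tangentSpace M q, v ≠ 0 →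
    ∀ ξ ∈ tangentSpace M q, ξ ≠ 0 → 0 < fundamentalTensor F q v ξ ξ

/-- `Ω̄ = Ω ∪ ∂Ω = Φ⁻¹(]-∞, 0])`, where `Ω = Φ⁻¹(]-∞, 0[)`. -/
def closedDomain {E : Type*} (M : Set E) (Φ : E → ℝ) : Set E := {q | q ∈ M ∧ Φ q ≤ 0}

/-- `∂Ω = Φ⁻¹(0)`. -/
def boundary {E : Type*} (M : Set E) (Φ : E → ℝ) : Set E := {q | q ∈ M ∧ Φ q = 0}

/-- `Φ : M → ℝ` is of class `C²`, has no critical point on `∂Ω`, and cuts out a compact `Ω̄`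
homeomorphic to the closed unit disk of `ℝ^N`. -/
structure IsDiskFunction {E : Type*} [NormedAddCommGroup E] [NormedSpace ℝ E]
    (N : ℕ) (M : Set E) (Φ : E → ℝ) : Prop where
  contDiffOn : ContDiffOn ℝ 2 Φ M
  regular : ∀ q ∈ boundary M Φ, ∃ v ∈ tangentSpace M q, differential M Φ q v ≠ 0
  isCompact : IsCompact (closedDomain M Φ)
  disk : Nonempty (closedDomain M Φ ≃ₜ Metric.closedBall (0 : EuclideanSpace ℝ (Fin N)) 1)

/-- `H^{1,2}([0,1], E)`: absolutely continuous on `[0,1]` with square integrable derivative.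
Curves are functions on `ℝ` whose values off `[0,1]` are irrelevant. -/
def IsH1 {E : Type*} [NormedAddCommGroup E] [NormedSpace ℝ E] (x : ℝ → E) : Prop :=
  AbsolutelyContinuousOnInterval x 0 1 ∧ MemLp (deriv x) 2 (volume.restrict (Icc (0 : ℝ) 1))

/-- The usual `H^{1,2}` norm. -/
def h1Norm {E : Type*} [NormedAddCommGroup E] [NormedSpace ℝ E] (ξ : ℝ → E) : ℝ :=
  Real.sqrt ((∫ s in (0 : ℝ)..1, ‖ξ s‖ ^ 2) + ∫ s in (0 : ℝ)..1, ‖deriv ξ s‖ ^ 2)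

/-- The norm `‖ξ‖_* = max {‖ξ(0)‖, ‖ξ(1)‖} + ‖ξ̇‖_{L²}`. -/
def starNorm {E : Type*} [NormedAddCommGroup E] [NormedSpace ℝ E] (ξ : ℝ → E) : ℝ :=
  max ‖ξ 0‖ ‖ξ 1‖ + Real.sqrt (∫ s in (0 : ℝ)..1, ‖deriv ξ s‖ ^ 2)

/-- The space `𝔐` of `H^{1,2}` curves in `Ω̄` with endpoints on `∂Ω`. -/
def curveSpace {E : Type*} [NormedAddCommGroup E] [NormedSpace ℝ E]
    (M : Set E) (Φ : E → ℝ) : Set (ℝ → E) :=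
  {x | IsH1 x ∧ (∀ s ∈ Icc (0 : ℝ) 1, x s ∈ closedDomain M Φ) ∧
    x 0 ∈ boundary M Φ ∧ x 1 ∈ boundary M Φ}

/-- The admissible infinitesimal variations `𝒱⁻(x)` of `x` in `𝔐`. -/
def admissibleVariations {E : Type*} [NormedAddCommGroup E] [NormedSpace ℝ E]
    (M : Set E) (Φ : E → ℝ) (x : ℝ → E) : Set (ℝ → E) :=
  {ξ | IsH1 ξ ∧ (∀ s ∈ Icc (0 : ℝ) 1, ξ s ∈ tangentSpace M (x s)) ∧
    differential M Φ (x 0) (ξ 0) = 0 ∧ differential M Φ (x 1) (ξ 1) = 0 ∧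
    ∀ s ∈ Ioo (0 : ℝ) 1, x s ∈ boundary M Φ → differential M Φ (x s) (ξ s) ≤ 0}

/-- The Finsler energy `𝒥(x) = ½ ∫₀¹ F²(x, ẋ) ds`. -/
def energy {E : Type*} [NormedAddCommGroup E] [NormedSpace ℝ E]
    (F : E × E → ℝ) (x : ℝ → E) : ℝ :=
  (1 / 2) * ∫ s in (0 : ℝ)..1, F (x s, deriv x s) ^ 2

/-- The differential of the energy, `d𝒥(x)[ξ] = ½ ∫₀¹ (d_q G(x, ẋ)[ξ] + d_v G(x, ẋ)[ξ̇]) ds`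
with `G = F²`. The integrand is the differential of `G : TM → ℝ` at `(x, ẋ)` applied to the vector
`(ξ, ξ̇)`, which is tangent to `TM` there for almost every `s`. -/
def energyDifferential {E : Type*} [NormedAddCommGroup E] [NormedSpace ℝ E]
    (M : Set E) (F : E × E → ℝ) (x ξ : ℝ → E) : ℝ :=
  (1 / 2) * ∫ s in (0 : ℝ)..1,
    differential (tangentBundle M) (fun p => F p ^ 2) (x s, deriv x s) (ξ s, deriv ξ s)

/-- `𝒱⁻`-Palais–Smale sequences for `𝒥` on `𝔐` at level `c`. -/
def IsPalaisSmale {E : Type*} [NormedAddCommGroup E] [NormedSpace ℝ E]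
    (M : Set E) (F : E × E → ℝ) (Φ : E → ℝ) (c : ℝ) (x : ℕ → ℝ → E) : Prop :=
  (∀ n, x n ∈ curveSpace M Φ) ∧
  Tendsto (fun n => energy F (x n)) atTop (𝓝 c) ∧
  ∃ ε : ℕ → ℝ, Tendsto ε atTop (𝓝[>] 0) ∧
    ∀ n, ∀ V ∈ admissibleVariations M Φ (x n), starNorm V = 1 →
      -ε n ≤ energyDifferential M F (x n) V

end

end FinslerChord

/-! The core is a monotonicity argument: each term of the sequence is tested with a variation
pointing towards another term. Coercivity of F² over the compact set Ω̄ turns the energy bound into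
an L² bound on velocities, and Arzelà–Ascoli gives a uniformly convergent subsequence. It remains to
show that its derivatives are Cauchy in L².

The flat variation x_m - x_n is neither tangent to M nor admissible at contacts with ∂Ω. It is
replaced by A(x_n, x_m), where A is a C¹ field on pairs with A(q,p) ∈ T_qM, A(q,q) = 0, diagonal
derivative ρ(b - a) with ρ > 0 on Ω̄, and dΦ(q)[A(q,p)] a nonnegative multiple of Φ(p) for q ∈ ∂Ω.
The last property makes it admissible for every curve x_m in Ω̄, with the equality required when
both endpoints lie on ∂Ω (`exists_isAdmissibleField`).

Palais–Smale bounds dJ(x_n)[A(x_n,x_m)] and dJ(x_m)[A(x_m,x_n)] below by vanishing quantities. The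
sum of the two integrands is `symmetricPairing`, 2-homogeneous in the velocities (a,b). At q = p it
equals ρ(d_vG(q,a) - d_vG(q,b))[b - a], which is negative for q ∈ Ω̄ and a ≠ b, since G is strictly
convex on the fibres. Compactness of the unit pairs extends this to base points close to each other,
at the price of a small error: |a-b|² ≤ ε(|a|²+|b|²) - C·pairing (`exists_norm_sub_sq_le`).
Integration gives the Cauchy property (`cauchy_deriv_of_palaisSmale`).

Two technical points recur. Derivatives within TM are computed by extending G to an open set through
a local retraction. On the zero section F² is only handled as a C¹ function, with vanishing
differential, so every estimate there comes from homogeneity. -/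

namespace FinslerChord

/-! ### Local retractions onto M and their lift to TM -/

section Retraction

variable {E : Type*} [NormedAddCommGroup E] [NormedSpace ℝ E]

/-- `r` is a `C³` retraction of the open set `O` onto `M ∩ O`. -/
structure IsLocalRetraction (M O : Set E) (r : E → E) : Prop where
  isOpen : IsOpen O
  contDiffOn : ContDiffOn ℝ 3 r O
  mapsTo : ∀ q ∈ O, r q ∈ M
  eq_self : ∀ q ∈ M, q ∈ O → r q = q

/-- Every point of `M` has a neighbourhood that `C³` retracts onto `M`. -/
def HasLocalRetractions (M : Set E) : Prop :=
  ∀ q ∈ M, ∃ O r, q ∈ O ∧ IsLocalRetraction M O r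

/-- In a flattening chart e, the retraction is e⁻¹ ∘ π ∘ e with π the orthogonal projection to W,
restricted to the points where π ∘ e stays in the target of e. -/
theorem IsSubmanifold.hasLocalRetractions {E : Type*} [NormedAddCommGroup E]
    [InnerProductSpace ℝ E] [FiniteDimensional ℝ E] {n : ℕ} {M : Set E}
    (hM : IsSubmanifold 3 n M) : HasLocalRetractions M := by
  intro q hq
  obtain ⟨e, W, hqe, -, he, hes, hMW⟩ := hM q hq
  have hproj : ∀ p ∈ M, p ∈ e.source → W.starProjection (e p) = e p := fun p hp hps =>
    Submodule.starProjection_eq_self_iff.2 (hMW.subset ⟨hps, hp⟩ : p ∈ e.source ∩ e ⁻¹' (W : Set E)).2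
  have hmaps : MapsTo (fun p => W.starProjection (e p))
      (e.source ∩ (fun p => W.starProjection (e p)) ⁻¹' e.target) e.target := fun p hp => hp.2
  have hπ : ContDiffOn ℝ 3 (fun p => W.starProjection (e p)) e.source :=
    W.starProjection.contDiff.comp_contDiffOn he
  refine ⟨e.source ∩ (fun p => W.starProjection (e p)) ⁻¹' e.target,
    fun p => e.symm (W.starProjection (e p)), ⟨hqe, ?_⟩, ?_, ?_, ?_, ?_⟩
  · change W.starProjection (e q) ∈ e.target
    rw [hproj q hq hqe]; exact e.map_source hqe
  · exact hπ.continuousOn.isOpen_inter_preimage e.open_source e.open_target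
  · exact hes.comp (hπ.mono inter_subset_left) hmaps
  · rintro p ⟨hp, hpt⟩
    have h1 : e.symm (W.starProjection (e p)) ∈ e.source ∩ e ⁻¹' (W : Set E) := by
      refine ⟨e.map_target hpt, ?_⟩
      change e (e.symm (W.starProjection (e p))) ∈ W
      rw [e.right_inv hpt]
      exact Submodule.starProjection_apply_mem _ _
    rw [← hMW] at h1
    exact h1.2
  · rintro p hp ⟨hps, -⟩
    simp only [hproj p hp hps, e.left_inv hps]

/-- The lift `(q, v) ↦ (r q, Dr(q) v)` of a map to tangent vectors. -/
noncomputable def tangentLift (r : E → E) (z : E × E) : E × E := (r z.1, fderiv ℝ r z.1 z.2)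

variable {M O : Set E} {r : E → E}

theorem smul_mem_tangentSpace {q v : E} (a : ℝ) (hv : v ∈ tangentSpace M q) :
    a • v ∈ tangentSpace M q := by
  obtain ⟨c, hc0, hc, hcM⟩ := hv
  refine ⟨fun t => c (a * t), by simpa using hc0, ?_, ?_⟩
  · have h1 : HasDerivAt (fun t : ℝ => a * t) a 0 := by simpa using (hasDerivAt_id (0 : ℝ)).const_mul a
    have h2 : HasDerivAt c v (a * 0) := by simpa using hc
    exact h2.scomp (0 : ℝ) h1
  · have : Tendsto (fun t : ℝ => a * t) (𝓝 0) (𝓝 0) := by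
      have : Continuous fun t : ℝ => a * t := by fun_prop
      simpa using this.tendsto 0
    exact this.eventually hcM

theorem zero_mem_tangentSpace {q : E} (hq : q ∈ M) : (0 : E) ∈ tangentSpace M q :=
  ⟨fun _ => q, rfl, hasDerivAt_const _ _, by simpa using hq⟩

theorem mem_tangentSpace_of_hasDerivAt {c : ℝ → E} {s : ℝ} {v : E} (hc : HasDerivAt c v s)
    (hM : ∀ᶠ t in 𝓝 s, c t ∈ M) : v ∈ tangentSpace M (c s) := by
  refine ⟨fun t => c (s + t), by simp, ?_, ?_⟩
  · have h2 : HasDerivAt c v (s + 0) := by simpa using hc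
    exact h2.comp_const_add s 0
  · have : Tendsto (fun t : ℝ => s + t) (𝓝 0) (𝓝 s) := by
      have : Continuous fun t : ℝ => s + t := by fun_prop
      simpa using this.tendsto 0
    exact this.eventually hM

namespace IsLocalRetraction

theorem mem_nhds (h : IsLocalRetraction M O r) {q : E} (hq : q ∈ O) : O ∈ 𝓝 q :=
  h.isOpen.mem_nhds hq

theorem hasFDerivAt (h : IsLocalRetraction M O r) {q : E} (hq : q ∈ O) :
    HasFDerivAt r (fderiv ℝ r q) q :=
  ((h.contDiffOn.contDiffAt (h.mem_nhds hq)).differentiableAt (by norm_num)).hasFDerivAt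

theorem contDiffOn_fderiv (h : IsLocalRetraction M O r) :
    ContDiffOn ℝ 2 (fderiv ℝ r) O :=
  h.contDiffOn.fderiv_of_isOpen h.isOpen (by norm_num)

theorem hasFDerivAt_fderiv (h : IsLocalRetraction M O r) {q : E} (hq : q ∈ O) :
    HasFDerivAt (fderiv ℝ r) (fderiv ℝ (fderiv ℝ r) q) q :=
  ((h.contDiffOn_fderiv.contDiffAt (h.mem_nhds hq)).differentiableAt (by norm_num)).hasFDerivAt

theorem fderiv_mem (h : IsLocalRetraction M O r) {q : E} (hq : q ∈ O) (v : E) :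
    fderiv ℝ r q v ∈ tangentSpace M (r q) := by
  have hl : HasDerivAt (fun t : ℝ => q + t • v) v 0 := by
    simpa using ((hasDerivAt_id (0 : ℝ)).smul_const v).const_add q
  have hc : ContinuousAt (fun t : ℝ => q + t • v) 0 := hl.continuousAt
  refine ⟨fun t => r (q + t • v), by simp, ?_, ?_⟩
  · have h1 : HasFDerivAt r (fderiv ℝ r q) (q + (0 : ℝ) • v) := by simpa using h.hasFDerivAt hq
    exact h1.comp_hasDerivAt 0 hl
  · have := hc.preimage_mem_nhds (t := O) (by simpa using h.mem_nhds hq)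
    filter_upwards [this] with t ht using h.mapsTo _ ht

theorem fderiv_eq_self (h : IsLocalRetraction M O r) {q v : E} (hq : q ∈ O)
    (hv : v ∈ tangentSpace M q) : fderiv ℝ r q v = v := by
  obtain ⟨c, rfl, hc, hcM⟩ := hv
  have h1 : HasDerivAt (fun t => r (c t)) (fderiv ℝ r (c 0) v) 0 :=
    (h.hasFDerivAt hq).comp_hasDerivAt 0 hc
  refine h1.unique (hc.congr_of_eventuallyEq ?_)
  filter_upwards [hcM, hc.continuousAt.preimage_mem_nhds (h.mem_nhds hq)] with t h2 h3
    using h.eq_self _ h2 h3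

/-- Replaces the description by curves with the fixed space of a linear map, from which closure of
T_qM under sums and differences follows. -/
theorem mem_tangentSpace_iff (h : IsLocalRetraction M O r) {q v : E} (hqM : q ∈ M) (hq : q ∈ O) :
    v ∈ tangentSpace M q ↔ fderiv ℝ r q v = v :=
  ⟨h.fderiv_eq_self hq, fun hv => by
    have := h.fderiv_mem hq v
    rwa [h.eq_self q hqM hq, hv] at this⟩

theorem tangentLift_mem (h : IsLocalRetraction M O r) {z : E × E} (hz : z.1 ∈ O) :
    tangentLift r z ∈ tangentBundle M :=
  ⟨h.mapsTo _ hz, h.fderiv_mem hz _⟩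

theorem tangentLift_eq_self (h : IsLocalRetraction M O r) {z : E × E} (hz : z.1 ∈ O)
    (hzM : z ∈ tangentBundle M) : tangentLift r z = z :=
  Prod.ext (h.eq_self _ hzM.1 hz) (h.fderiv_eq_self hz hzM.2)

theorem contDiffOn_tangentLift (h : IsLocalRetraction M O r) :
    ContDiffOn ℝ 2 (tangentLift r) (O ×ˢ univ) := by
  have hfst : MapsTo (Prod.fst : E × E → E) (O ×ˢ univ) O := fun z hz => hz.1
  refine ContDiffOn.prodMk ((h.contDiffOn.of_le (by norm_num)).comp contDiffOn_fst hfst) ?_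
  exact (h.contDiffOn_fderiv.comp contDiffOn_fst hfst).clm_apply contDiffOn_snd

theorem hasFDerivAt_tangentLift (h : IsLocalRetraction M O r) {z : E × E} (hz : z.1 ∈ O) :
    HasFDerivAt (tangentLift r) (fderiv ℝ (tangentLift r) z) z :=
  ((h.contDiffOn_tangentLift.contDiffAt ((h.isOpen.prod isOpen_univ).mem_nhds
    ⟨hz, mem_univ _⟩)).differentiableAt (by norm_num)).hasFDerivAt

theorem fderiv_tangentLift_apply (h : IsLocalRetraction M O r) {z : E × E} (hz : z.1 ∈ O)
    (ξ η : E) : fderiv ℝ (tangentLift r) z (ξ, η) =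
      (fderiv ℝ r z.1 ξ, fderiv ℝ (fderiv ℝ r) z.1 ξ z.2 + fderiv ℝ r z.1 η) := by
  have h1 : HasFDerivAt (fun w : E × E => r w.1)
      ((fderiv ℝ r z.1).comp (ContinuousLinearMap.fst ℝ E E)) z :=
    (h.hasFDerivAt hz).comp z hasFDerivAt_fst
  have h2 : HasFDerivAt (fun w : E × E => fderiv ℝ r w.1)
      ((fderiv ℝ (fderiv ℝ r) z.1).comp (ContinuousLinearMap.fst ℝ E E)) z :=
    (h.hasFDerivAt_fderiv hz).comp z hasFDerivAt_fst
  have h3 := h1.prodMk (h2.clm_apply (hasFDerivAt_snd (𝕜 := ℝ) (E := E) (F := E)))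
  have h4 : fderiv ℝ (tangentLift r) z = _ := HasFDerivAt.fderiv h3
  rw [h4]
  simp [add_comm]

/-- Says that (A, DA) is tangent to TM at (q, a). Differentiating Dr(c)A(c,d) = A(c,d) along curves
of M produces D²r(a, A), whereas the lift's derivative contains D²r(A, a); symmetry of the second
derivative reconciles them. -/
theorem fderiv_tangentLift_field (h : IsLocalRetraction M O r) {A : E × E → E}
    {A' : E × E →L[ℝ] E} {q p a b : E} (hq : q ∈ O) (hA : HasFDerivAt A A' (q, p))
    (hAM : ∀ q ∈ M, ∀ p ∈ M, A (q, p) ∈ tangentSpace M q)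
    (ha : a ∈ tangentSpace M q) (hb : b ∈ tangentSpace M p) :
    fderiv ℝ (tangentLift r) (q, a) (A (q, p), A' (a, b)) = (A (q, p), A' (a, b)) := by
  obtain ⟨c, rfl, hc, hcM⟩ := ha
  obtain ⟨d, rfl, hd, hdM⟩ := hb
  have hg : HasDerivAt (fun t => A (c t, d t)) (A' (a, b)) 0 :=
    HasFDerivAt.comp_hasDerivAt (f := fun t => (c t, d t)) 0 hA (hc.prodMk hd)
  have hDr : HasDerivAt (fun t => fderiv ℝ r (c t)) (fderiv ℝ (fderiv ℝ r) (c 0) a) 0 :=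
    (h.hasFDerivAt_fderiv hq).comp_hasDerivAt 0 hc
  have h1 := hDr.clm_apply hg
  have h2 : (fun t => fderiv ℝ r (c t) (A (c t, d t))) =ᶠ[𝓝 0] fun t => A (c t, d t) := by
    filter_upwards [hcM, hdM, hc.continuousAt.preimage_mem_nhds (h.mem_nhds hq)] with t h2 h3 h4
      using h.fderiv_eq_self h4 (hAM _ h2 _ h3)
  have h3 := h1.unique (hg.congr_of_eventuallyEq h2)
  have hs : IsSymmSndFDerivAt ℝ r (c 0) :=
    (h.contDiffOn.contDiffAt (h.mem_nhds hq)).isSymmSndFDerivAt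
      (by rw [minSmoothness_of_isRCLikeNormedField]; norm_num)
  rw [h.fderiv_tangentLift_apply hq]
  refine Prod.ext (h.fderiv_eq_self hq (hAM _ hcM.self_of_nhds _ hdM.self_of_nhds)) ?_
  change fderiv ℝ (fderiv ℝ r) (c 0) (A (c 0, d 0)) a + _ = _
  rw [hs.eq]
  exact h3

end IsLocalRetraction

end Retraction

/-! ### Two-sided bounds and C¹ regularity of F² up to the zero section -/

section Finsler

variable {E : Type*} [NormedAddCommGroup E] [NormedSpace ℝ E]
  {M K : Set E} {F : E × E → ℝ}

/-- Locally TM is the fixed-point set of the continuous map `tangentLift r`, so limits of tangent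
vectors over K remain tangent. -/
theorem isClosed_tangentBundle_over [FiniteDimensional ℝ E] (hM : HasLocalRetractions M) (hK : IsClosed K) (hKM : K ⊆ M) :
    IsClosed {z : E × E | z ∈ tangentBundle M ∧ z.1 ∈ K} := by
  refine isClosed_of_closure_subset fun z hz => ?_
  have hzK : z.1 ∈ K := by
    have : closure {z : E × E | z ∈ tangentBundle M ∧ z.1 ∈ K} ⊆ Prod.fst ⁻¹' K :=
      closure_minimal (fun w hw => hw.2) (hK.preimage continuous_fst)
    exact this hz
  obtain ⟨O, r, hO, h⟩ := hM _ (hKM hzK)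
  have hzO : O ×ˢ univ ∈ 𝓝 z := (h.isOpen.prod isOpen_univ).mem_nhds ⟨hO, mem_univ _⟩
  have : (𝓝[{z : E × E | z ∈ tangentBundle M ∧ z.1 ∈ K}] z).NeBot := mem_closure_iff_nhdsWithin_neBot.1 hz
  have hcont : ContinuousAt (tangentLift r) z := (h.hasFDerivAt_tangentLift hO).continuousAt
  have heq : tangentLift r z = z := by
    refine tendsto_nhds_unique (hcont.mono_left nhdsWithin_le_nhds)
      (Tendsto.congr' ?_ (tendsto_id.mono_left nhdsWithin_le_nhds))
      (l := 𝓝[{z : E × E | z ∈ tangentBundle M ∧ z.1 ∈ K}] z)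
    filter_upwards [self_mem_nhdsWithin, nhdsWithin_le_nhds hzO] with w hw hwO
    exact (h.tangentLift_eq_self hwO.1 hw.1).symm
  exact ⟨heq ▸ h.tangentLift_mem hO, hzK⟩

theorem isCompact_unitTangentBundle [FiniteDimensional ℝ E] (hM : HasLocalRetractions M) (hK : IsCompact K) (hKM : K ⊆ M) :
    IsCompact {z : E × E | (z ∈ tangentBundle M ∧ z.1 ∈ K) ∧ ‖z.2‖ = 1} := by
  refine (hK.prod (isCompact_closedBall (0 : E) 1)).of_isClosed_subset
    ((isClosed_tangentBundle_over hM hK.isClosed hKM).inter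
      (isClosed_eq (by fun_prop) continuous_const)) ?_
  rintro z ⟨hz, hz1⟩
  exact ⟨hz.2, by simpa using le_of_eq hz1⟩

theorem HasLocalRetractions.exists_isCompact [FiniteDimensional ℝ E] (hM : HasLocalRetractions M) {q : E} (hq : q ∈ M) :
    ∃ ε > 0, IsCompact (M ∩ Metric.closedBall q ε) := by
  obtain ⟨O, r, hO, h⟩ := hM _ hq
  obtain ⟨ε, hε, hεO⟩ := Metric.nhds_basis_closedBall.mem_iff.1 (h.mem_nhds hO)
  refine ⟨ε, hε, (isCompact_closedBall q ε).of_isClosed_subset ?_ inter_subset_right⟩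
  have : M ∩ Metric.closedBall q ε = {p ∈ Metric.closedBall q ε | r p = p} := by
    ext p
    refine ⟨fun hp => ⟨hp.2, h.eq_self p hp.1 (hεO hp.2)⟩, fun hp => ⟨?_, hp.1⟩⟩
    rw [← hp.2]; exact h.mapsTo p (hεO hp.1)
  rw [this]
  have hc : ContinuousOn (fun p => r p - p) (Metric.closedBall q ε) :=
    (h.contDiffOn.continuousOn.mono hεO).sub continuousOn_id
  have := hc.preimage_isClosed_of_isClosed Metric.isClosed_closedBall (isClosed_singleton (x := 0))
  convert this using 1
  ext p
  simp [sub_eq_zero]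

namespace IsFinslerMetric

theorem apply_zero (hF : IsFinslerMetric M F) {q : E} (hq : q ∈ M) : F (q, 0) = 0 := by
  have := hF.homogeneous q hq 0 (zero_mem_tangentSpace hq) 2 (by norm_num)
  simp only [smul_zero] at this
  linarith

theorem sq_smul (hF : IsFinslerMetric M F) {z : E × E} (hz : z ∈ tangentBundle M) {a : ℝ}
    (ha : 0 < a) : F (z.1, a • z.2) ^ 2 = a ^ 2 * F z ^ 2 := by
  rw [hF.homogeneous _ hz.1 _ hz.2 a ha]; ring

theorem sq_eq (hF : IsFinslerMetric M F) {z : E × E} (hz : z ∈ tangentBundle M) (h0 : z.2 ≠ 0) :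
    F z ^ 2 = ‖z.2‖ ^ 2 * F (z.1, ‖z.2‖⁻¹ • z.2) ^ 2 := by
  have h : 0 < ‖z.2‖ := norm_pos_iff.2 h0
  rw [hF.sq_smul hz (inv_pos.2 h)]
  field_simp

theorem normalize_mem {z : E × E} (hz : z ∈ tangentBundle M) (hzK : z.1 ∈ K) (h0 : z.2 ≠ 0) :
    (z.1, ‖z.2‖⁻¹ • z.2) ∈ {z : E × E | (z ∈ tangentBundle M ∧ z.1 ∈ K) ∧ ‖z.2‖ = 1} := by
  refine ⟨⟨⟨hz.1, smul_mem_tangentSpace _ hz.2⟩, hzK⟩, ?_⟩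
  have h : ‖z.2‖ ≠ 0 := norm_ne_zero_iff.2 h0
  simp [norm_smul, h]

theorem exists_sq_le [FiniteDimensional ℝ E] (hF : IsFinslerMetric M F) (hM : HasLocalRetractions M) (hK : IsCompact K)
    (hKM : K ⊆ M) :
    ∃ C : ℝ, 0 ≤ C ∧ ∀ z ∈ tangentBundle M, z.1 ∈ K → F z ^ 2 ≤ C * ‖z.2‖ ^ 2 := by
  obtain ⟨C, hC⟩ := (isCompact_unitTangentBundle hM hK hKM).exists_bound_of_continuousOn
    ((hF.continuousOn.pow 2).mono fun z hz => hz.1.1)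
  refine ⟨max C 0, le_max_right _ _, fun z hz hzK => ?_⟩
  by_cases h0 : z.2 = 0
  · have : F z = 0 := by
      have := hF.apply_zero hz.1
      rwa [← h0] at this
    simp [this, h0]
  · rw [hF.sq_eq hz h0, mul_comm]
    gcongr
    have := hC _ (normalize_mem hz hzK h0)
    exact (le_abs_self _).trans (this.trans (le_max_left _ _))

theorem exists_le_sq [FiniteDimensional ℝ E] (hF : IsFinslerMetric M F) (hM : HasLocalRetractions M) (hK : IsCompact K)
    (hKM : K ⊆ M) :
    ∃ m : ℝ, 0 < m ∧ ∀ z ∈ tangentBundle M, z.1 ∈ K → m * ‖z.2‖ ^ 2 ≤ F z ^ 2 := by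
  have hcont : ContinuousOn (fun z => F z ^ 2)
      {z : E × E | (z ∈ tangentBundle M ∧ z.1 ∈ K) ∧ ‖z.2‖ = 1} :=
    (hF.continuousOn.pow 2).mono fun z hz => hz.1.1
  have key : ∃ m : ℝ, 0 < m ∧
      ∀ z ∈ {z : E × E | (z ∈ tangentBundle M ∧ z.1 ∈ K) ∧ ‖z.2‖ = 1}, m ≤ F z ^ 2 := by
    rcases eq_empty_or_nonempty
      {z : E × E | (z ∈ tangentBundle M ∧ z.1 ∈ K) ∧ ‖z.2‖ = 1} with he | hne
    · exact ⟨1, one_pos, by simp [he]⟩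
    · obtain ⟨z, hz, hmin⟩ := (isCompact_unitTangentBundle hM hK hKM).exists_isMinOn hne hcont
      refine ⟨F z ^ 2, ?_, fun w hw => hmin hw⟩
      have h0 : z.2 ≠ 0 := by rw [← norm_ne_zero_iff, hz.2]; norm_num
      have := hF.pos z.1 hz.1.1.1 z.2 hz.1.1.2 h0
      positivity
  obtain ⟨m, hm, h⟩ := key
  refine ⟨m, hm, fun z hz hzK => ?_⟩
  by_cases h0 : z.2 = 0
  · simp only [h0, norm_zero, ne_eq, OfNat.ofNat_ne_zero, not_false_eq_true, zero_pow, mul_zero]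
    positivity
  · rw [hF.sq_eq hz h0, mul_comm m]
    gcongr
    exact h _ (normalize_mem hz hzK h0)

/-- Over a compact neighbourhood of q in M, 0 ≤ F² ≤ C‖v‖², which is quadratically small at (q, 0).
-/
theorem hasFDerivWithinAt_zero [FiniteDimensional ℝ E] (hF : IsFinslerMetric M F) (hM : HasLocalRetractions M) {q : E}
    (hq : q ∈ M) :
    HasFDerivWithinAt (fun z => F z ^ 2) (0 : E × E →L[ℝ] ℝ) (tangentBundle M) (q, 0) := by
  obtain ⟨ε, hε, hc⟩ := hM.exists_isCompact hq
  obtain ⟨C, hC0, hC⟩ := hF.exists_sq_le hM hc inter_subset_left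
  rw [hasFDerivWithinAt_iff_isLittleO]
  have h1 : (fun z : E × E => F z ^ 2) =O[𝓝[tangentBundle M] (q, 0)] fun z => ‖z - (q, 0)‖ ^ 2 := by
    refine Asymptotics.IsBigO.of_bound C ?_
    have hn : Prod.fst ⁻¹' Metric.closedBall q ε ∈ 𝓝 ((q, 0) : E × E) :=
      continuous_fst.continuousAt.preimage_mem_nhds (Metric.closedBall_mem_nhds q hε)
    filter_upwards [self_mem_nhdsWithin, nhdsWithin_le_nhds hn] with z hz hzq
    have h2 : ‖z.2‖ ≤ ‖z - (q, 0)‖ := by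
      have := norm_snd_le (z - (q, 0))
      rwa [Prod.snd_sub, sub_zero] at this
    calc ‖F z ^ 2‖ = F z ^ 2 := by rw [Real.norm_of_nonneg (sq_nonneg _)]
      _ ≤ C * ‖z.2‖ ^ 2 := hC z hz ⟨hz.1, hzq⟩
      _ ≤ C * ‖z - (q, 0)‖ ^ 2 := by gcongr
      _ = C * ‖‖z - (q, 0)‖ ^ 2‖ := by simp
  have h2 : (fun z : E × E => ‖z - (q, 0)‖ ^ 2) =o[𝓝[tangentBundle M] (q, 0)]
      fun z => z - (q, 0) := by
    have h3 : Tendsto (fun z : E × E => ‖z - (q, 0)‖) (𝓝 (q, 0)) (𝓝 0) := by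
      have : Continuous fun z : E × E => ‖z - (q, 0)‖ := by fun_prop
      simpa using this.tendsto (q, 0)
    have h4 : (fun z : E × E => ‖z - (q, 0)‖) =o[𝓝[tangentBundle M] (q, 0)]
      (fun _ => (1 : ℝ)) := (Asymptotics.isLittleO_one_iff ℝ).2 (h3.mono_left nhdsWithin_le_nhds)
    have h5 := h4.mul_isBigO (Asymptotics.isBigO_refl (fun z : E × E => ‖z - (q, 0)‖) _)
    simpa [sq] using h5.norm_right
  have := h1.trans_isLittleO h2
  simpa [hF.apply_zero hq] using this

theorem differentiableWithinAt [FiniteDimensional ℝ E] (hF : IsFinslerMetric M F) (hM : HasLocalRetractions M) {z : E × E}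
    (hz : z ∈ tangentBundle M) :
    DifferentiableWithinAt ℝ (fun z => F z ^ 2) (tangentBundle M) z := by
  by_cases h0 : z.2 = 0
  · have := hF.hasFDerivWithinAt_zero hM hz.1
    rw [← h0] at this
    exact this.differentiableWithinAt
  · have h1 : DifferentiableWithinAt ℝ F {p | p ∈ tangentBundle M ∧ p.2 ≠ 0} z :=
      (hF.contDiffOn z ⟨hz, h0⟩).differentiableWithinAt (by norm_num)
    have h2 : DifferentiableWithinAt ℝ F (tangentBundle M) z := by
      refine h1.mono_of_mem_nhdsWithin ?_
      have : {p : E × E | p.2 ≠ 0} ∈ 𝓝 z :=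
        (isOpen_ne_fun continuous_snd continuous_const).mem_nhds h0
      exact inter_mem self_mem_nhdsWithin (nhdsWithin_le_nhds this)
    exact h2.pow 2

variable {O : Set E} {r : E → E}

/-- Composition with the lift gives a function on an open set that agrees with F² on TM. The chain
rule identifies the two derivatives on vectors fixed by the derivative of the lift, which serve as
the tangent vectors of TM. -/
theorem differential_eq [FiniteDimensional ℝ E] (hF : IsFinslerMetric M F) (hM : HasLocalRetractions M)
    (h : IsLocalRetraction M O r) {z : E × E} (hz : z ∈ tangentBundle M) (hzO : z.1 ∈ O)
    {ζ : E × E} (hζ : fderiv ℝ (tangentLift r) z ζ = ζ) :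
    differential (tangentBundle M) (fun p => F p ^ 2) z ζ =
      fderiv ℝ (fun w => F (tangentLift r w) ^ 2) z ζ := by
  have h1 := (hF.differentiableWithinAt hM hz).hasFDerivWithinAt
  rw [← h.tangentLift_eq_self hzO hz] at h1
  have h2 := h1.comp z (h.hasFDerivAt_tangentLift hzO).hasFDerivWithinAt
    (s := O ×ˢ univ) (fun w hw => h.tangentLift_mem hw.1)
  have h3 := h2.hasFDerivAt ((h.isOpen.prod isOpen_univ).mem_nhds ⟨hzO, mem_univ _⟩)
  have h4 : fderiv ℝ (fun w => F (tangentLift r w) ^ 2) z = _ := h3.fderiv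
  rw [h4, ContinuousLinearMap.comp_apply, hζ, h.tangentLift_eq_self hzO hz]
  rfl

theorem fderiv_extension_zero [FiniteDimensional ℝ E] (hF : IsFinslerMetric M F) (hM : HasLocalRetractions M)
    (h : IsLocalRetraction M O r) {z : E × E} (hz : z ∈ tangentBundle M) (hzO : z.1 ∈ O)
    (h0 : z.2 = 0) : fderiv ℝ (fun w => F (tangentLift r w) ^ 2) z = 0 := by
  have h1 := hF.hasFDerivWithinAt_zero hM hz.1
  rw [← h0, ← h.tangentLift_eq_self hzO hz] at h1
  have h2 := h1.comp z (h.hasFDerivAt_tangentLift hzO).hasFDerivWithinAt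
    (s := O ×ˢ univ) (fun w hw => h.tangentLift_mem hw.1)
  have h3 := h2.hasFDerivAt ((h.isOpen.prod isOpen_univ).mem_nhds ⟨hzO, mem_univ _⟩)
  exact (h3.fderiv : fderiv ℝ (fun w => F (tangentLift r w) ^ 2) z = _).trans (by simp)

theorem contDiffAt_extension (hF : IsFinslerMetric M F)
    (h : IsLocalRetraction M O r) {z : E × E} (hz : z ∈ tangentBundle M) (hzO : z.1 ∈ O)
    (h0 : z.2 ≠ 0) : ContDiffAt ℝ 1 (fun w => F (tangentLift r w) ^ 2) z := by
  have hc : ContinuousAt (tangentLift r) z := (h.hasFDerivAt_tangentLift hzO).continuousAt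
  have hn : O ×ˢ univ ∩ {w | (tangentLift r w).2 ≠ 0} ∈ 𝓝 z := by
    refine inter_mem ((h.isOpen.prod isOpen_univ).mem_nhds ⟨hzO, mem_univ _⟩) ?_
    refine hc.preimage_mem_nhds ((isOpen_ne_fun continuous_snd continuous_const).mem_nhds ?_)
    rwa [h.tangentLift_eq_self hzO hz]
  have h1 : ContDiffOn ℝ 1 (fun w => F (tangentLift r w))
      (O ×ˢ univ ∩ {w | (tangentLift r w).2 ≠ 0}) :=
    (hF.contDiffOn.of_le (by norm_num)).comp
      ((h.contDiffOn_tangentLift.of_le (by norm_num)).mono inter_subset_left)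
      fun w hw => ⟨h.tangentLift_mem hw.1.1, hw.2⟩
  exact (h1.pow 2).contDiffAt hn

theorem differentiableAt_extension [FiniteDimensional ℝ E] (hF : IsFinslerMetric M F)
    (hM : HasLocalRetractions M) (h : IsLocalRetraction M O r) {z : E × E}
    (hz : z ∈ tangentBundle M) (hzO : z.1 ∈ O) :
    DifferentiableAt ℝ (fun w => F (tangentLift r w) ^ 2) z := by
  have h1 := (hF.differentiableWithinAt hM hz).hasFDerivWithinAt
  rw [← h.tangentLift_eq_self hzO hz] at h1
  have h2 := h1.comp z (h.hasFDerivAt_tangentLift hzO).hasFDerivWithinAt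
    (s := O ×ˢ univ) (fun w hw => h.tangentLift_mem hw.1)
  exact (h2.hasFDerivAt ((h.isOpen.prod isOpen_univ).mem_nhds ⟨hzO, mem_univ _⟩)).differentiableAt

/-- Chain rule applied to G(q, av) = a²G(q, v); the lift is linear in v, so the extension inherits
the homogeneity. -/
theorem fderiv_extension_smul [FiniteDimensional ℝ E] (hF : IsFinslerMetric M F)
    (hM : HasLocalRetractions M) (h : IsLocalRetraction M O r) {z : E × E}
    (hz : z ∈ tangentBundle M) (hzO : z.1 ∈ O) {a : ℝ} (ha : 0 < a) (ζ : E × E) :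
    fderiv ℝ (fun w => F (tangentLift r w) ^ 2) (z.1, a • z.2) (ζ.1, a • ζ.2) =
      a ^ 2 * fderiv ℝ (fun w => F (tangentLift r w) ^ 2) z ζ := by
  set G := fun w => F (tangentLift r w) ^ 2 with hG
  let S : E × E →L[ℝ] E × E :=
    (ContinuousLinearMap.fst ℝ E E).prod (a • ContinuousLinearMap.snd ℝ E E)
  have hd : HasFDerivAt G (fderiv ℝ G (S z)) (S z) :=
    (hF.differentiableAt_extension hM h (z := S z)
      ⟨hz.1, smul_mem_tangentSpace _ hz.2⟩ hzO).hasFDerivAt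
  have h1 : HasFDerivAt (fun w => G (S w)) ((fderiv ℝ G (S z)).comp S) z :=
    hd.comp z S.hasFDerivAt
  have h2 : (fun w => G (S w)) =ᶠ[𝓝 z] fun w => a ^ 2 * G w := by
    filter_upwards [(h.isOpen.prod isOpen_univ).mem_nhds ⟨hzO, mem_univ _⟩] with w hw
    have h3 : tangentLift r (S w) = ((tangentLift r w).1, a • (tangentLift r w).2) := by
      simp [tangentLift, S]
    simp only [hG, h3]
    exact hF.sq_smul (h.tangentLift_mem hw.1) ha
  have h4 := ((hF.differentiableAt_extension hM h hz hzO).hasFDerivAt.const_mul (a ^ 2))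
  have h5 := (h4.congr_of_eventuallyEq h2).unique h1
  exact (DFunLike.congr_fun h5 ζ).symm

theorem norm_fderiv_extension_le [FiniteDimensional ℝ E] (hF : IsFinslerMetric M F)
    (hM : HasLocalRetractions M) (h : IsLocalRetraction M O r) {z : E × E}
    (hz : z ∈ tangentBundle M) (hzO : z.1 ∈ O) (h0 : z.2 ≠ 0) :
    ‖fderiv ℝ (fun w => F (tangentLift r w) ^ 2) z‖ ≤
      ‖fderiv ℝ (fun w => F (tangentLift r w) ^ 2) (z.1, ‖z.2‖⁻¹ • z.2)‖ *
        (‖z.2‖ * (‖z.2‖ + 1)) := by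
  have hs := hF.fderiv_extension_smul hM h hz hzO (inv_pos.2 (norm_pos_iff.2 h0))
  set G := fun w => F (tangentLift r w) ^ 2 with hG
  set l := ‖z.2‖ with hl
  have hl0 : 0 < l := norm_pos_iff.2 h0
  refine ContinuousLinearMap.opNorm_le_bound _ (by positivity) fun ζ => ?_
  have hζ : ‖(ζ.1, l⁻¹ • ζ.2)‖ ≤ (1 + l⁻¹) * ‖ζ‖ := by
    have h5 := mul_le_mul_of_nonneg_left (norm_snd_le ζ) (inv_pos.2 hl0).le
    have h6 : 0 ≤ l⁻¹ * ‖ζ‖ := by positivity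
    refine max_le ?_ ?_
    · simp only
      linarith [norm_fst_le ζ]
    · simp only [norm_smul, norm_inv, Real.norm_of_nonneg hl0.le]
      linarith [norm_nonneg ζ]
  have h1 : fderiv ℝ G z ζ = l ^ 2 * fderiv ℝ G (z.1, l⁻¹ • z.2) (ζ.1, l⁻¹ • ζ.2) := by
    rw [hs]; field_simp
  calc ‖fderiv ℝ G z ζ‖ = l ^ 2 * ‖fderiv ℝ G (z.1, l⁻¹ • z.2) (ζ.1, l⁻¹ • ζ.2)‖ := by
        rw [h1, norm_mul]; simp
    _ ≤ l ^ 2 * (‖fderiv ℝ G (z.1, l⁻¹ • z.2)‖ * ((1 + l⁻¹) * ‖ζ‖)) := by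
        gcongr
        exact (ContinuousLinearMap.le_opNorm _ _).trans (by gcongr)
    _ = ‖fderiv ℝ G (z.1, l⁻¹ • z.2)‖ * (l * (l + 1)) * ‖ζ‖ := by
        field_simp

/-- Off the zero section this is C¹ smoothness. At a zero vector the derivative vanishes, and nearby
it is at most C‖v‖(‖v‖ + 1), with C the bound on unit vectors over a compact neighbourhood. -/
theorem continuousOn_fderiv_extension [FiniteDimensional ℝ E] (hF : IsFinslerMetric M F) (hM : HasLocalRetractions M)
    (h : IsLocalRetraction M O r) :
    ContinuousOn (fderiv ℝ fun w => F (tangentLift r w) ^ 2) (tangentBundle M ∩ O ×ˢ univ) := by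
  set G := fun w => F (tangentLift r w) ^ 2 with hG
  have hne : ∀ z ∈ tangentBundle M, z.1 ∈ O → z.2 ≠ 0 → ContinuousAt (fderiv ℝ G) z :=
    fun z hz hzO h0 => ((hF.contDiffAt_extension h hz hzO h0).fderiv_right
      (m := 0) (by norm_num)).continuousAt
  rintro z ⟨hz, hzO, -⟩
  by_cases h0 : z.2 = 0
  swap
  · exact (hne z hz hzO h0).continuousWithinAt
  obtain ⟨ε₁, hε₁, hc⟩ := hM.exists_isCompact hz.1
  obtain ⟨ε₂, hε₂, hεO⟩ := Metric.nhds_basis_closedBall.mem_iff.1 (h.mem_nhds hzO)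
  have hK : IsCompact (M ∩ Metric.closedBall z.1 ε₁ ∩ Metric.closedBall z.1 ε₂) :=
    hc.inter_right Metric.isClosed_closedBall
  obtain ⟨C, hC⟩ := (isCompact_unitTangentBundle hM hK
    (inter_subset_left.trans inter_subset_left)).exists_bound_of_continuousOn (f := fderiv ℝ G)
    fun w hw => (hne w hw.1.1 (hεO hw.1.2.2)
      (by rw [← norm_ne_zero_iff, hw.2]; norm_num)).continuousWithinAt
  have hzero : fderiv ℝ G z = 0 := hF.fderiv_extension_zero hM h hz hzO h0
  rw [ContinuousWithinAt, hzero, tendsto_zero_iff_norm_tendsto_zero]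
  have hlim : Tendsto (fun w : E × E => C * (‖w.2‖ * (‖w.2‖ + 1)))
      (𝓝[tangentBundle M ∩ O ×ˢ univ] z) (𝓝 0) := by
    have : Continuous fun w : E × E => C * (‖w.2‖ * (‖w.2‖ + 1)) := by fun_prop
    have := this.tendsto z
    simp only [h0, norm_zero, zero_mul, mul_zero] at this
    exact this.mono_left nhdsWithin_le_nhds
  refine squeeze_zero' (Eventually.of_forall fun _ => norm_nonneg _) ?_ hlim
  have hn : Prod.fst ⁻¹' (Metric.closedBall z.1 ε₁ ∩ Metric.closedBall z.1 ε₂) ∈ 𝓝 z :=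
    continuous_fst.continuousAt.preimage_mem_nhds
      (inter_mem (Metric.closedBall_mem_nhds _ hε₁) (Metric.closedBall_mem_nhds _ hε₂))
  filter_upwards [self_mem_nhdsWithin, nhdsWithin_le_nhds hn] with w hw hwn
  by_cases hw0 : w.2 = 0
  · simp [hF.fderiv_extension_zero hM h hw.1 hw.2.1 hw0, hw0, G]
  · refine (hF.norm_fderiv_extension_le hM h hw.1 hw.2.1 hw0).trans ?_
    gcongr
    exact hC _ (normalize_mem hw.1 ⟨⟨hw.1.1, hwn.1⟩, hwn.2⟩ hw0)

end IsFinslerMetric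

end Finsler

/-! ### Test integrands on pairs of curves -/

section Pairing

variable {E : Type*} [NormedAddCommGroup E] [NormedSpace ℝ E]
  {M K : Set E} {F : E × E → ℝ}

theorem HasLocalRetractions.add_mem_tangentSpace (hM : HasLocalRetractions M) {q v w : E}
    (hq : q ∈ M) (hv : v ∈ tangentSpace M q) (hw : w ∈ tangentSpace M q) :
    v + w ∈ tangentSpace M q := by
  obtain ⟨O, r, hO, h⟩ := hM q hq
  rw [h.mem_tangentSpace_iff hq hO] at *
  rw [map_add, hv, hw]

theorem HasLocalRetractions.sub_mem_tangentSpace (hM : HasLocalRetractions M) {q v w : E}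
    (hq : q ∈ M) (hv : v ∈ tangentSpace M q) (hw : w ∈ tangentSpace M q) :
    v - w ∈ tangentSpace M q := by
  obtain ⟨O, r, hO, h⟩ := hM q hq
  rw [h.mem_tangentSpace_iff hq hO] at *
  rw [map_sub, hv, hw]

/-- Pairs of tangent vectors of `M` with base points in `K`, as tuples `((q, p), (a, b))` with
`a ∈ T_q M`, `b ∈ T_p M`. -/
def tangentPairs (M K : Set E) : Set ((E × E) × (E × E)) :=
  {y | ((y.1.1, y.2.1) ∈ tangentBundle M ∧ y.1.1 ∈ K) ∧
    (y.1.2, y.2.2) ∈ tangentBundle M ∧ y.1.2 ∈ K}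

/-- The integrand of the differential of the energy at a curve `x` applied to `A(x, y)`, as a
function of `((x, y), (ẋ, ẏ))`. -/
noncomputable def energyPairing (M : Set E) (F : E × E → ℝ) (A : E × E → E)
    (y : (E × E) × (E × E)) : ℝ :=
  differential (tangentBundle M) (fun p => F p ^ 2) (y.1.1, y.2.1) (A y.1, fderiv ℝ A y.1 y.2)

/-- The integrand of the differential of the energy at `x` applied to `A(x, y)` plus the one
at `y` applied to `A(y, x)`. -/
noncomputable def symmetricPairing (M : Set E) (F : E × E → ℝ) (A : E × E → E)
    (y : (E × E) × (E × E)) : ℝ :=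
  energyPairing M F A y + energyPairing M F A (y.1.swap, y.2.swap)

theorem swap_mem_tangentPairs {y : (E × E) × (E × E)} (hy : y ∈ tangentPairs M K) :
    (y.1.swap, y.2.swap) ∈ tangentPairs M K := ⟨hy.2, hy.1⟩

theorem smul_mem_tangentPairs {y : (E × E) × (E × E)} (hy : y ∈ tangentPairs M K) (a : ℝ) :
    (y.1, a • y.2) ∈ tangentPairs M K :=
  ⟨⟨⟨hy.1.1.1, smul_mem_tangentSpace a hy.1.1.2⟩, hy.1.2⟩,
    ⟨⟨hy.2.1.1, smul_mem_tangentSpace a hy.2.1.2⟩, hy.2.2⟩⟩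

theorem isCompact_unit_tangentPairs [FiniteDimensional ℝ E] (hM : HasLocalRetractions M)
    (hK : IsCompact K) (hKM : K ⊆ M) :
    IsCompact {y ∈ tangentPairs M K | ‖y.2.1‖ ^ 2 + ‖y.2.2‖ ^ 2 = 1} := by
  have hcl := isClosed_tangentBundle_over hM hK.isClosed hKM
  refine ((hK.prod hK).prod ((isCompact_closedBall (0 : E) 1).prod
    (isCompact_closedBall (0 : E) 1))).of_isClosed_subset (IsClosed.inter (IsClosed.inter
      (hcl.preimage (f := fun y : (E × E) × (E × E) => (y.1.1, y.2.1)) (by fun_prop))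
      (hcl.preimage (f := fun y : (E × E) × (E × E) => (y.1.2, y.2.2)) (by fun_prop)))
      (isClosed_eq (by fun_prop) continuous_const)) ?_
  rintro y ⟨hy, hy1⟩
  refine ⟨⟨hy.1.2, hy.2.2⟩, ?_, ?_⟩
  · rw [mem_closedBall_zero_iff]
    nlinarith [sq_nonneg ‖y.2.2‖, norm_nonneg y.2.1]
  · rw [mem_closedBall_zero_iff]
    nlinarith [sq_nonneg ‖y.2.1‖, norm_nonneg y.2.2]

/-- Only unit velocities over the same base points y.1 are compared, so a restriction on the base
points, such as their being close, survives the rescaling. -/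
theorem le_of_forall_unit_le {f : (E × E) × (E × E) → ℝ}
    (hf0 : ∀ y ∈ tangentPairs M K, y.2 = 0 → f y = 0)
    (hf : ∀ y ∈ tangentPairs M K, ∀ a : ℝ, 0 < a → f (y.1, a • y.2) = a ^ 2 * f y)
    {C : ℝ} {y : (E × E) × (E × E)} (hy : y ∈ tangentPairs M K)
    (h : ∀ v : E × E, (y.1, v) ∈ tangentPairs M K → ‖v.1‖ ^ 2 + ‖v.2‖ ^ 2 = 1 → f (y.1, v) ≤ C) :
    f y ≤ C * (‖y.2.1‖ ^ 2 + ‖y.2.2‖ ^ 2) := by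
  by_cases h0 : y.2 = 0
  · rw [hf0 y hy h0]; simp [h0]
  have hpos : 0 < ‖y.2.1‖ ^ 2 + ‖y.2.2‖ ^ 2 := by
    rcases not_and_or.1 (mt Prod.mk_eq_zero.2 h0) with h1 | h1 <;>
    · have := norm_pos_iff.2 h1
      positivity
  set l := √(‖y.2.1‖ ^ 2 + ‖y.2.2‖ ^ 2) with hl
  have hl0 : 0 < l := Real.sqrt_pos.2 hpos
  have hl2 : l ^ 2 = ‖y.2.1‖ ^ 2 + ‖y.2.2‖ ^ 2 := Real.sq_sqrt hpos.le
  have h1 := h (l⁻¹ • y.2) (smul_mem_tangentPairs hy l⁻¹) (by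
    simp only [Prod.smul_fst, Prod.smul_snd, norm_smul, norm_inv, Real.norm_of_nonneg hl0.le,
      mul_pow]
    rw [← mul_add, ← hl2]; field_simp)
  rw [hf y hy l⁻¹ (inv_pos.2 hl0), inv_pow, inv_mul_le_iff₀ (by positivity)] at h1
  rw [← hl2]; linarith

namespace IsFinslerMetric

variable [FiniteDimensional ℝ E]

theorem energyPairing_eq (hF : IsFinslerMetric M F) (hM : HasLocalRetractions M)
    {A : E × E → E} (hA : ContDiff ℝ 1 A) (hAM : ∀ q ∈ M, ∀ p ∈ M, A (q, p) ∈ tangentSpace M q)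
    {O : Set E} {r : E → E} (h : IsLocalRetraction M O r) {y : (E × E) × (E × E)}
    (hy : y ∈ tangentPairs M K) (hO : y.1.1 ∈ O) :
    energyPairing M F A y = fderiv ℝ (fun w => F (tangentLift r w) ^ 2) (y.1.1, y.2.1)
      (A y.1, fderiv ℝ A y.1 y.2) :=
  hF.differential_eq hM h hy.1.1 hO (h.fderiv_tangentLift_field hO
    ((hA.differentiable one_ne_zero).differentiableAt.hasFDerivAt) hAM hy.1.1.2 hy.2.1.2)

theorem continuousOn_energyPairing (hF : IsFinslerMetric M F) (hM : HasLocalRetractions M)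
    {A : E × E → E} (hA : ContDiff ℝ 1 A)
    (hAM : ∀ q ∈ M, ∀ p ∈ M, A (q, p) ∈ tangentSpace M q) :
    ContinuousOn (energyPairing M F A) (tangentPairs M K) := by
  intro y hy
  obtain ⟨O, r, hO, h⟩ := hM _ hy.1.1.1
  have hn : {y : (E × E) × (E × E) | y.1.1 ∈ O} ∈ 𝓝 y :=
    (h.isOpen.preimage (continuous_fst.comp continuous_fst)).mem_nhds hO
  have h1 : ContinuousOn (fun y : (E × E) × (E × E) =>
      fderiv ℝ (fun w => F (tangentLift r w) ^ 2) (y.1.1, y.2.1) (A y.1, fderiv ℝ A y.1 y.2))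
      (tangentPairs M K ∩ {y | y.1.1 ∈ O}) := by
    refine ContinuousOn.clm_apply ?_ (Continuous.continuousOn ?_)
    · exact (hF.continuousOn_fderiv_extension hM h).comp (by fun_prop)
        fun w hw => ⟨hw.1.1.1, hw.2, mem_univ _⟩
    · have := hA.continuous
      have := hA.continuous_fderiv one_ne_zero
      fun_prop
  have h2 := ((h1 y ⟨hy, hO⟩).congr (fun w hw => hF.energyPairing_eq hM hA hAM h hw.1 hw.2)
    (hF.energyPairing_eq hM hA hAM h hy hO))
  exact h2.mono_of_mem_nhdsWithin (inter_mem self_mem_nhdsWithin (nhdsWithin_le_nhds hn))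

/-- Rescaling the velocities fixes A and rescales its derivative: exactly the horizontal and
vertical scaling of `fderiv_extension_smul`. -/
theorem energyPairing_smul (hF : IsFinslerMetric M F) (hM : HasLocalRetractions M)
    {A : E × E → E} (hA : ContDiff ℝ 1 A)
    (hAM : ∀ q ∈ M, ∀ p ∈ M, A (q, p) ∈ tangentSpace M q) {y : (E × E) × (E × E)}
    (hy : y ∈ tangentPairs M K) {a : ℝ} (ha : 0 < a) :
    energyPairing M F A (y.1, a • y.2) = a ^ 2 * energyPairing M F A y := by
  obtain ⟨O, r, hO, h⟩ := hM _ hy.1.1.1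
  rw [hF.energyPairing_eq hM hA hAM h hy hO,
    hF.energyPairing_eq hM hA hAM h (smul_mem_tangentPairs hy a) hO,
    ← hF.fderiv_extension_smul hM h hy.1.1 hO ha]
  simp

theorem energyPairing_zero (hF : IsFinslerMetric M F) (hM : HasLocalRetractions M)
    {A : E × E → E} (hA : ContDiff ℝ 1 A)
    (hAM : ∀ q ∈ M, ∀ p ∈ M, A (q, p) ∈ tangentSpace M q) {y : (E × E) × (E × E)}
    (hy : y ∈ tangentPairs M K) (h0 : y.2 = 0) : energyPairing M F A y = 0 := by
  obtain ⟨O, r, hO, h⟩ := hM _ hy.1.1.1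
  rw [hF.energyPairing_eq hM hA hAM h hy hO,
    hF.fderiv_extension_zero hM h hy.1.1 hO (by simp [h0])]
  rfl

theorem continuousOn_symmetricPairing (hF : IsFinslerMetric M F) (hM : HasLocalRetractions M)
    {A : E × E → E} (hA : ContDiff ℝ 1 A)
    (hAM : ∀ q ∈ M, ∀ p ∈ M, A (q, p) ∈ tangentSpace M q) :
    ContinuousOn (symmetricPairing M F A) (tangentPairs M K) :=
  (hF.continuousOn_energyPairing hM hA hAM).add
    ((hF.continuousOn_energyPairing hM hA hAM).comp (by fun_prop)
      fun _ hy => swap_mem_tangentPairs hy)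

theorem exists_energyPairing_le (hF : IsFinslerMetric M F) (hM : HasLocalRetractions M)
    (hK : IsCompact K) (hKM : K ⊆ M) {A : E × E → E} (hA : ContDiff ℝ 1 A)
    (hAM : ∀ q ∈ M, ∀ p ∈ M, A (q, p) ∈ tangentSpace M q) :
    ∃ C : ℝ, ∀ y ∈ tangentPairs M K,
      ‖energyPairing M F A y‖ ≤ C * (‖y.2.1‖ ^ 2 + ‖y.2.2‖ ^ 2) := by
  obtain ⟨C, hC⟩ := (isCompact_unit_tangentPairs hM hK hKM).exists_bound_of_continuousOn
    ((hF.continuousOn_energyPairing hM hA hAM).mono fun _ hy => hy.1)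
  refine ⟨C, fun y hy => le_of_forall_unit_le (M := M) (K := K) ?_ ?_ hy
    (f := fun y => ‖energyPairing M F A y‖) fun v hv hv1 => hC _ ⟨hv, hv1⟩⟩
  · intro y hy h0
    simp [hF.energyPairing_zero hM hA hAM hy h0]
  · intro y hy a ha
    simp [hF.energyPairing_smul hM hA hAM hy ha]

/-! ### Strict convexity of F² on the fibres -/

section Convexity

variable {q a ξ : E}

theorem differential_vertical (hF : IsFinslerMetric M F) (hM : HasLocalRetractions M)
    (hq : q ∈ M) (ha : a ∈ tangentSpace M q) (hξ : ξ ∈ tangentSpace M q) :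
    differential (tangentBundle M) (fun p => F p ^ 2) (q, a) (0, ξ) =
      deriv (fun t : ℝ => F (q, a + t • ξ) ^ 2) 0 := by
  have hl : HasDerivAt (fun t : ℝ => a + t • ξ) ξ 0 := by
    simpa using ((hasDerivAt_id (0 : ℝ)).smul_const ξ).const_add a
  exact differential_apply_eq_deriv (c := fun t : ℝ => (q, a + t • ξ))
    (hF.differentiableWithinAt hM ⟨hq, ha⟩) (by simp) ((hasDerivAt_const (0 : ℝ) q).prodMk hl)
    (Eventually.of_forall fun t => ⟨hq, hM.add_mem_tangentSpace hq ha
      (smul_mem_tangentSpace t hξ)⟩)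

theorem deriv_line (hF : IsFinslerMetric M F) (hM : HasLocalRetractions M)
    (hq : q ∈ M) (ha : a ∈ tangentSpace M q) (hξ : ξ ∈ tangentSpace M q) (t : ℝ) :
    deriv (fun t : ℝ => F (q, a + t • ξ) ^ 2) t =
      differential (tangentBundle M) (fun p => F p ^ 2) (q, a + t • ξ) (0, ξ) := by
  rw [hF.differential_vertical hM hq (hM.add_mem_tangentSpace hq ha
      (smul_mem_tangentSpace t hξ)) hξ]
  have h1 := deriv_comp_const_add (fun t : ℝ => F (q, a + t • ξ) ^ 2) t 0
  rw [add_zero] at h1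
  rw [← h1]
  simp only [add_smul, add_assoc]

omit [FiniteDimensional ℝ E] in
theorem deriv_deriv_line (F : E × E → ℝ) (q a ξ : E) (t : ℝ) :
    deriv (deriv fun t : ℝ => F (q, a + t • ξ) ^ 2) t =
      2 * fundamentalTensor F q (a + t • ξ) ξ ξ := by
  set k := fun t : ℝ => F (q, a + t • ξ) ^ 2 with hk
  have h1 : ∀ s : ℝ, deriv (fun τ : ℝ => F (q, a + t • ξ + s • ξ + τ • ξ) ^ 2) 0 =
      deriv k (t + s) := by
    intro s
    have h2 := deriv_comp_const_add k (t + s) 0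
    rw [add_zero] at h2
    rw [← h2]
    simp only [hk, add_smul, add_assoc]
  have h3 := deriv_comp_const_add (deriv k) t 0
  rw [add_zero] at h3
  simp only [fundamentalTensor, h1, h3]
  ring

theorem continuous_deriv_line (hF : IsFinslerMetric M F) (hM : HasLocalRetractions M)
    (hq : q ∈ M) (ha : a ∈ tangentSpace M q) (hξ : ξ ∈ tangentSpace M q) :
    Continuous (deriv fun t : ℝ => F (q, a + t • ξ) ^ 2) := by
  obtain ⟨O, r, hO, h⟩ := hM q hq
  have hmem : ∀ t : ℝ, a + t • ξ ∈ tangentSpace M q := fun t =>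
    hM.add_mem_tangentSpace hq ha (smul_mem_tangentSpace t hξ)
  have h1 : (deriv fun t : ℝ => F (q, a + t • ξ) ^ 2) = fun t =>
      fderiv ℝ (fun w => F (tangentLift r w) ^ 2) (q, a + t • ξ) (0, ξ) := by
    ext t
    rw [hF.deriv_line hM hq ha hξ]
    refine hF.differential_eq hM h ⟨hq, hmem t⟩ hO ?_
    rw [h.fderiv_tangentLift_apply hO, h.fderiv_eq_self hO hξ]
    simp
  rw [h1, ← continuousOn_univ]
  refine ContinuousOn.clm_apply ?_ continuousOn_const
  exact (hF.continuousOn_fderiv_extension hM h).comp (by fun_prop)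
    fun t _ => ⟨⟨hq, hmem t⟩, hO, mem_univ _⟩

/-- The second derivative along the line is 2g(ξ, ξ) > 0 except at the single parameter, if any,
where the line meets the origin. There continuity of the first derivative glues the two half-lines.
-/
theorem strictMono_deriv_line (hF : IsFinslerMetric M F) (hM : HasLocalRetractions M)
    (hq : q ∈ M) (ha : a ∈ tangentSpace M q) (hξ : ξ ∈ tangentSpace M q) (h0 : ξ ≠ 0) :
    StrictMono (deriv fun t : ℝ => F (q, a + t • ξ) ^ 2) := by
  have hc := hF.continuous_deriv_line hM hq ha hξ
  have hpos : ∀ t : ℝ, a + t • ξ ≠ 0 → 0 < deriv (deriv fun t : ℝ => F (q, a + t • ξ) ^ 2) t := by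
    intro t ht
    rw [deriv_deriv_line]
    have := hF.posDef q hq _ (hM.add_mem_tangentSpace hq ha (smul_mem_tangentSpace t hξ)) ht ξ hξ h0
    positivity
  by_cases hz : ∃ c : ℝ, a + c • ξ = 0
  · obtain ⟨c, hcz⟩ := hz
    have hne : ∀ t : ℝ, t ≠ c → a + t • ξ ≠ 0 := fun t ht h => ht <| by
      have : (t - c) • ξ = 0 := by rw [sub_smul, sub_eq_zero]; exact add_left_cancel (h.trans hcz.symm)
      exact sub_eq_zero.1 ((smul_eq_zero.1 this).resolve_right h0)
    refine StrictMonoOn.Iic_union_Ici (a := c) ?_ ?_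
    · refine strictMonoOn_of_deriv_pos (convex_Iic c) hc.continuousOn fun t ht => ?_
      rw [interior_Iic] at ht
      exact hpos t (hne t (ne_of_lt ht))
    · refine strictMonoOn_of_deriv_pos (convex_Ici c) hc.continuousOn fun t ht => ?_
      rw [interior_Ici] at ht
      exact hpos t (hne t (ne_of_gt ht))
  · push Not at hz
    exact strictMono_of_deriv_pos fun t => hpos t (hz t)

theorem differential_vertical_lt (hF : IsFinslerMetric M F) (hM : HasLocalRetractions M) {b : E}
    (hq : q ∈ M) (ha : a ∈ tangentSpace M q) (hb : b ∈ tangentSpace M q) (hab : a ≠ b) :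
    differential (tangentBundle M) (fun p => F p ^ 2) (q, a) (0, b - a) <
      differential (tangentBundle M) (fun p => F p ^ 2) (q, b) (0, b - a) := by
  have hξ := hM.sub_mem_tangentSpace hq hb ha
  have := hF.strictMono_deriv_line hM hq ha hξ (sub_ne_zero.2 hab.symm) (zero_lt_one (α := ℝ))
  rw [hF.deriv_line hM hq ha hξ, hF.deriv_line hM hq ha hξ] at this
  simpa using this

end Convexity

end IsFinslerMetric

/-- A `C¹` field `A` such that `A(q, p) ∈ T_q M` for `q, p ∈ M` points from `q` to `p` to first
order at the diagonal of `s` and that is compatible with the constraint `Φ ≤ 0`. -/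
structure IsAdmissibleField (M : Set E) (Φ : E → ℝ) (s : Set E) (A : E × E → E) : Prop where
  contDiff : ContDiff ℝ 1 A
  mem_tangentSpace : ∀ q ∈ M, ∀ p ∈ M, A (q, p) ∈ tangentSpace M q
  diag : ∀ q ∈ M, A (q, q) = 0
  fderiv_diag : ∀ q ∈ M, ∃ ρ : ℝ, 0 ≤ ρ ∧ (q ∈ s → 0 < ρ) ∧ ∀ a ∈ tangentSpace M q,
    ∀ b ∈ tangentSpace M q, fderiv ℝ A (q, q) (a, b) = ρ • (b - a)
  nonpos : ∀ q ∈ boundary M Φ, ∀ p ∈ closedDomain M Φ, differential M Φ q (A (q, p)) ≤ 0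
  eq_zero : ∀ q ∈ boundary M Φ, ∀ p ∈ boundary M Φ, differential M Φ q (A (q, p)) = 0

variable {Φ : E → ℝ}

/-- As A(q,q) = 0, only vertical derivatives survive, and the sum is ρ(d_vG(q,a) - d_vG(q,b))[b -
a]: strict monotonicity of d_vG on the fibre. -/
theorem IsFinslerMetric.symmetricPairing_diag [FiniteDimensional ℝ E] (hF : IsFinslerMetric M F)
    (hM : HasLocalRetractions M) {A : E × E → E} (hA : IsAdmissibleField M Φ K A) {q a b : E}
    (hq : q ∈ M) (ha : a ∈ tangentSpace M q) (hb : b ∈ tangentSpace M q) :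
    symmetricPairing M F A ((q, q), (a, b)) ≤ 0 ∧
      (q ∈ K → a ≠ b → symmetricPairing M F A ((q, q), (a, b)) < 0) := by
  obtain ⟨ρ, hρ, hρK, h⟩ := hA.fderiv_diag q hq
  have hsm : ∀ v η : E, differential (tangentBundle M) (fun p => F p ^ 2) (q, v) (0, ρ • η) =
      ρ * differential (tangentBundle M) (fun p => F p ^ 2) (q, v) (0, η) := fun v η => by
    have : ((0, ρ • η) : E × E) = ρ • ((0, η) : E × E) := by simp
    rw [differential, this, map_smul]; rfl
  have hneg : differential (tangentBundle M) (fun p => F p ^ 2) (q, b) (0, a - b) =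
      -differential (tangentBundle M) (fun p => F p ^ 2) (q, b) (0, b - a) := by
    have : ((0, a - b) : E × E) = -((0, b - a) : E × E) := by simp
    rw [differential, this, map_neg]; rfl
  have heq : symmetricPairing M F A ((q, q), (a, b)) =
      ρ * (differential (tangentBundle M) (fun p => F p ^ 2) (q, a) (0, b - a) -
        differential (tangentBundle M) (fun p => F p ^ 2) (q, b) (0, b - a)) := by
    simp only [symmetricPairing, energyPairing, Prod.swap_prod_mk, hA.diag q hq, h a ha b hb,
      h b hb a ha, hsm, hneg]
    ring
  rw [heq]
  by_cases hab : a = b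
  · simp [hab]
  have hlt := hF.differential_vertical_lt hM hq ha hb hab
  exact ⟨mul_nonpos_of_nonneg_of_nonpos hρ (sub_nonpos.2 hlt.le),
    fun hqK _ => mul_neg_of_pos_of_neg (hρK hqK) (sub_neg.2 hlt)⟩

/-- By homogeneity it is enough to treat the compact set T of unit pairs. The inequality is strict
on its diagonal part, hence persists, weakly, for nearby base points. The ε term is needed because
the pairing degenerates as a - b → 0. -/
theorem IsFinslerMetric.exists_norm_sub_sq_le [FiniteDimensional ℝ E] (hF : IsFinslerMetric M F)
    (hM : HasLocalRetractions M) (hK : IsCompact K) (hKM : K ⊆ M) {A : E × E → E}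
    (hA : IsAdmissibleField M Φ K A) {ε : ℝ} (hε : 0 < ε) :
    ∃ C > 0, ∃ δ > 0, ∀ y ∈ tangentPairs M K, dist y.1.1 y.1.2 < δ →
      ‖y.2.1 - y.2.2‖ ^ 2 ≤
        ε * (‖y.2.1‖ ^ 2 + ‖y.2.2‖ ^ 2) - C * symmetricPairing M F A y := by
  set T := {y ∈ tangentPairs M K | ‖y.2.1‖ ^ 2 + ‖y.2.2‖ ^ 2 = 1} with hT
  have hTc : IsCompact T := isCompact_unit_tangentPairs hM hK hKM
  have hf : ContinuousOn (symmetricPairing M F A) T :=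
    (hF.continuousOn_symmetricPairing hM hA.contDiff hA.mem_tangentSpace).mono fun y hy => hy.1
  have hdiag : ∀ y ∈ T, y.1.1 = y.1.2 → symmetricPairing M F A y ≤ 0 ∧
      (y.2.1 ≠ y.2.2 → symmetricPairing M F A y < 0) := by
    rintro ⟨⟨q, p⟩, ⟨a, b⟩⟩ ⟨hy, -⟩ hqp
    obtain rfl : q = p := hqp
    have := hF.symmetricPairing_diag hM hA hy.1.1.1 hy.1.1.2 hy.2.1.2
    exact ⟨this.1, this.2 hy.1.2⟩
  have h1 : ∃ c > 0, ∀ y ∈ T, y.1.1 = y.1.2 → ε ≤ ‖y.2.1 - y.2.2‖ ^ 2 →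
      symmetricPairing M F A y ≤ -c := by
    set D := T ∩ ({y | y.1.1 = y.1.2} ∩ {y | ε ≤ ‖y.2.1 - y.2.2‖ ^ 2}) with hD
    have hDc : IsCompact D := hTc.inter_right
      ((isClosed_eq (by fun_prop) (by fun_prop)).inter (isClosed_le (by fun_prop) (by fun_prop)))
    rcases D.eq_empty_or_nonempty with he | hne
    · exact ⟨1, one_pos, fun y hy h2 h3 => absurd (show y ∈ D from ⟨hy, h2, h3⟩) (by simp [he])⟩
    · obtain ⟨z, hz, hmax⟩ := hDc.exists_isMaxOn hne (hf.mono inter_subset_left)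
      refine ⟨-symmetricPairing M F A z, neg_pos.2 ((hdiag z hz.1 hz.2.1).2 fun h => ?_),
        fun y hy h2 h3 => by rw [neg_neg]; exact hmax ⟨hy, h2, h3⟩⟩
      have := hz.2.2
      simp only [mem_ofPred_eq, h, sub_self, norm_zero] at this
      norm_num at this
      linarith
  obtain ⟨c, hc, hc'⟩ := h1
  -- The factor 4/c works since ‖a-b‖² ≤ 2 on T, while 4/c times a pairing at most -c is at most -4.
  have hg : ContinuousOn (fun y => ‖y.2.1 - y.2.2‖ ^ 2 + 4 / c * symmetricPairing M F A y) T :=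
    ContinuousOn.add (by fun_prop) (continuousOn_const.mul hf)
  have h2 : ∀ y ∈ T, y.1.1 = y.1.2 →
      ‖y.2.1 - y.2.2‖ ^ 2 + 4 / c * symmetricPairing M F A y < ε := by
    intro y hy hq
    by_cases h3 : ε ≤ ‖y.2.1 - y.2.2‖ ^ 2
    · have h4 : 4 / c * symmetricPairing M F A y ≤ 4 / c * (-c) :=
        mul_le_mul_of_nonneg_left (hc' y hy hq h3) (by positivity)
      have h5 : 4 / c * (-c) = -4 := by field_simp
      have h6 := norm_sub_le y.2.1 y.2.2
      have h7 : ‖y.2.1 - y.2.2‖ ^ 2 ≤ (‖y.2.1‖ + ‖y.2.2‖) ^ 2 := by gcongr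
      have h8 : ‖y.2.1‖ ^ 2 + ‖y.2.2‖ ^ 2 = 1 := hy.2
      nlinarith [sq_nonneg (‖y.2.1‖ - ‖y.2.2‖)]
    · have h4 : 4 / c * symmetricPairing M F A y ≤ 0 :=
        mul_nonpos_of_nonneg_of_nonpos (by positivity) (hdiag y hy hq).1
      linarith
  have h3 : ∃ δ > 0, ∀ y ∈ T, dist y.1.1 y.1.2 < δ →
      ‖y.2.1 - y.2.2‖ ^ 2 + 4 / c * symmetricPairing M F A y ≤ ε := by
    set B := T ∩ (fun y => ‖y.2.1 - y.2.2‖ ^ 2 + 4 / c * symmetricPairing M F A y) ⁻¹' Ici ε with hB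
    have hBc : IsCompact B := hTc.of_isClosed_subset
      (hg.preimage_isClosed_of_isClosed hTc.isClosed isClosed_Ici) inter_subset_left
    rcases B.eq_empty_or_nonempty with he | hne
    · refine ⟨1, one_pos, fun y hy _ => ?_⟩
      by_contra h
      exact absurd (show y ∈ B from ⟨hy, (not_le.1 h).le⟩) (by simp [he])
    -- δ is the distance from the diagonal to the compact set B where the desired strict bound
    -- fails; it is positive because B misses the diagonal.
    · obtain ⟨z, hz, hmin⟩ := hBc.exists_isMinOn hne (f := fun y => dist y.1.1 y.1.2)
        (by fun_prop)
      refine ⟨dist z.1.1 z.1.2, dist_pos.2 fun h => (h2 z hz.1 h).not_ge hz.2, fun y hy hd => ?_⟩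
      by_contra h
      exact (hmin (show y ∈ B from ⟨hy, (not_le.1 h).le⟩)).not_gt hd
  obtain ⟨δ, hδ, h4⟩ := h3
  refine ⟨4 / c, by positivity, δ, hδ, fun y hy hd => ?_⟩
  have h5 := le_of_forall_unit_le (M := M) (K := K)
    (f := fun y => ‖y.2.1 - y.2.2‖ ^ 2 + 4 / c * symmetricPairing M F A y) (C := ε) ?_ ?_ hy
    fun v hv hv1 => h4 (y.1, v) ⟨hv, hv1⟩ hd
  · linarith
  · intro y hy h0
    have h6 := hF.energyPairing_zero hM hA.contDiff hA.mem_tangentSpace hy h0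
    have h7 := hF.energyPairing_zero hM hA.contDiff hA.mem_tangentSpace
      (swap_mem_tangentPairs hy) (by simp [h0])
    simp only [symmetricPairing, h6, h7]
    simp [h0]
  · intro y hy a ha
    have h6 := hF.energyPairing_smul hM hA.contDiff hA.mem_tangentSpace hy ha
    have h7 := hF.energyPairing_smul hM hA.contDiff hA.mem_tangentSpace
      (swap_mem_tangentPairs hy) ha
    have h8 : (a • y.2).swap = a • y.2.swap := rfl
    simp only [symmetricPairing, h6, h8, h7, Prod.smul_fst, Prod.smul_snd, ← smul_sub, norm_smul,
      mul_pow, Real.norm_eq_abs, sq_abs]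
    ring

end Pairing

/-! ### Construction of the admissible field -/

section AdmissibleField

variable {E : Type*} [NormedAddCommGroup E] [NormedSpace ℝ E]
  {M : Set E} {Φ : E → ℝ}

theorem IsAdmissibleField.mono {s t : Set E} {A : E × E → E} (hA : IsAdmissibleField M Φ t A)
    (hst : s ⊆ t) : IsAdmissibleField M Φ s A where
  contDiff := hA.contDiff
  mem_tangentSpace := hA.mem_tangentSpace
  diag := hA.diag
  fderiv_diag q hq := by
    obtain ⟨ρ, h0, h1, h2⟩ := hA.fderiv_diag q hq
    exact ⟨ρ, h0, fun h => h1 (hst h), h2⟩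
  nonpos := hA.nonpos
  eq_zero := hA.eq_zero

theorem isAdmissibleField_empty (M : Set E) (Φ : E → ℝ) : IsAdmissibleField M Φ ∅ 0 where
  contDiff := contDiff_const
  mem_tangentSpace _ hq _ _ := zero_mem_tangentSpace hq
  diag _ _ := rfl
  fderiv_diag q hq := ⟨0, le_rfl, fun h => h.elim, by simp⟩
  nonpos _ _ _ _ := by simp [differential]
  eq_zero _ _ _ _ := by simp [differential]

/-- All the conditions are linear or conic, and the factors ρ ≥ 0 add. Local fields can therefore be
summed without normalizing a partition of unity. -/
theorem IsAdmissibleField.add (hM : HasLocalRetractions M) {s t : Set E} {A B : E × E → E}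
    (hA : IsAdmissibleField M Φ s A) (hB : IsAdmissibleField M Φ t B) :
    IsAdmissibleField M Φ (s ∪ t) (A + B) where
  contDiff := hA.contDiff.add hB.contDiff
  mem_tangentSpace q hq p hp :=
    hM.add_mem_tangentSpace hq (hA.mem_tangentSpace q hq p hp) (hB.mem_tangentSpace q hq p hp)
  diag q hq := by simp [hA.diag q hq, hB.diag q hq]
  fderiv_diag q hq := by
    obtain ⟨ρ, h0, h1, h2⟩ := hA.fderiv_diag q hq
    obtain ⟨σ, h0', h1', h2'⟩ := hB.fderiv_diag q hq
    refine ⟨ρ + σ, add_nonneg h0 h0', ?_, fun a ha b hb => ?_⟩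
    · rintro (h | h)
      · exact add_pos_of_pos_of_nonneg (h1 h) h0'
      · exact add_pos_of_nonneg_of_pos h0 (h1' h)
    · rw [fderiv_add (hA.contDiff.differentiable one_ne_zero).differentiableAt
        (hB.contDiff.differentiable one_ne_zero).differentiableAt, add_apply,
        h2 a ha b hb, h2' a ha b hb, add_smul]
  nonpos q hq p hp := by
    have h1 := hA.nonpos q hq p hp
    have h2 := hB.nonpos q hq p hp
    simp only [differential, Pi.add_apply, map_add] at *
    exact add_nonpos h1 h2
  eq_zero q hq p hp := by
    have h1 := hA.eq_zero q hq p hp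
    have h2 := hB.eq_zero q hq p hp
    simp only [differential, Pi.add_apply, map_add] at *
    rw [h1, h2, add_zero]

/-- Multiplication by a cut-off function makes a local field into a global one. -/
theorem exists_isAdmissibleField_of_local [FiniteDimensional ℝ E] {q₀ : E} {U : Set E} (hU : IsOpen U)
    (hq₀ : q₀ ∈ U) {B : E × E → E} (hB : ContDiffOn ℝ 1 B (U ×ˢ U))
    (hBM : ∀ q ∈ M, q ∈ U → ∀ p ∈ M, p ∈ U → B (q, p) ∈ tangentSpace M q)
    (hdiag : ∀ q ∈ M, q ∈ U → B (q, q) = 0)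
    (hfderiv : ∀ q ∈ M, q ∈ U → ∀ a ∈ tangentSpace M q, ∀ b ∈ tangentSpace M q,
      fderiv ℝ B (q, q) (a, b) = b - a)
    (hΦ : ∀ q ∈ boundary M Φ, q ∈ U → ∀ p ∈ M, p ∈ U → differential M Φ q (B (q, p)) = Φ p) :
    ∃ t ∈ 𝓝 q₀, ∃ A, IsAdmissibleField M Φ t A := by
  obtain ⟨ε, hε, hεU⟩ := Metric.nhds_basis_closedBall.mem_iff.1 (hU.mem_nhds hq₀)
  let f : ContDiffBump q₀ := ⟨ε / 2, ε, by positivity, by linarith⟩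
  have hf0 : ∀ q, q ∉ U → f q = 0 := fun q hq => by
    refine f.zero_of_le_dist (not_lt.1 fun h => hq (hεU ?_))
    exact Metric.mem_closedBall.2 h.le
  have hout : ∀ q, q ∉ Metric.closedBall q₀ ε → ∀ᶠ p in 𝓝 q, f p = 0 := fun q hq => by
    filter_upwards [Metric.isClosed_closedBall.isOpen_compl.mem_nhds hq] with p hp
    exact f.zero_of_le_dist (not_le.1 fun h => hp (Metric.mem_closedBall.2 h)).le
  have hfc : ContDiff ℝ 1 f := f.contDiff
  have hm : ContDiff ℝ 1 fun z : E × E => f z.1 * f z.2 :=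
    (hfc.comp contDiff_fst).mul (hfc.comp contDiff_snd)
  have hUU : ∀ z : E × E, z.1 ∈ U → z.2 ∈ U → U ×ˢ U ∈ 𝓝 z := fun z h1 h2 =>
    (hU.prod hU).mem_nhds ⟨h1, h2⟩
  have hzero : ∀ z : E × E, ¬(z.1 ∈ Metric.closedBall q₀ ε ∧ z.2 ∈ Metric.closedBall q₀ ε) →
      (fun z : E × E => (f z.1 * f z.2) • B z) =ᶠ[𝓝 z] fun _ => 0 := by
    intro z hz
    rcases not_and_or.1 hz with h | h
    · filter_upwards [continuous_fst.continuousAt.eventually (hout _ h)] with w hw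
      simp [hw]
    · filter_upwards [continuous_snd.continuousAt.eventually (hout _ h)] with w hw
      simp [hw]
  have hdiff : ∀ q ∈ boundary M Φ, ∀ p ∈ M,
      differential M Φ q ((f q * f p) • B (q, p)) = f q * f p * Φ p := by
    intro q hq p hp
    by_cases h : q ∈ U ∧ p ∈ U
    · rw [← hΦ q hq h.1 p hp h.2, differential, map_smul]; rfl
    · rcases not_and_or.1 h with h | h <;> simp [hf0 _ h, differential]
  refine ⟨Metric.closedBall q₀ (ε / 2), Metric.closedBall_mem_nhds _ (by positivity),
    fun z => (f z.1 * f z.2) • B z, ?_, ?_, ?_, ?_, ?_, ?_⟩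
  · refine contDiff_iff_contDiffAt.2 fun z => ?_
    by_cases hz : z.1 ∈ Metric.closedBall q₀ ε ∧ z.2 ∈ Metric.closedBall q₀ ε
    · exact hm.contDiffAt.smul (hB.contDiffAt (hUU z (hεU hz.1) (hεU hz.2)))
    · exact contDiffAt_const.congr_of_eventuallyEq (hzero z hz)
  · intro q hq p hp
    by_cases h : q ∈ U ∧ p ∈ U
    · exact smul_mem_tangentSpace _ (hBM q hq h.1 p hp h.2)
    · have : f q * f p = 0 := by rcases not_and_or.1 h with h | h <;> simp [hf0 _ h]
      simpa [this] using zero_mem_tangentSpace hq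
  · intro q hq
    by_cases h : q ∈ U
    · simp [hdiag q hq h]
    · simp [hf0 _ h]
  · intro q hq
    by_cases h : q ∈ Metric.closedBall q₀ ε
    · have hqU := hεU h
      refine ⟨f q * f q, mul_self_nonneg _, fun hqs => ?_, fun a ha b hb => ?_⟩
      · rw [f.one_of_mem_closedBall hqs]; norm_num
      -- The term with the differentiated cut-off carries the factor B(q,q) = 0, so ρ = f(q)².
      · have h1 := (hm.differentiable one_ne_zero (q, q)).hasFDerivAt
        have h2 := ((hB.contDiffAt (hUU (q, q) hqU hqU)).differentiableAt one_ne_zero).hasFDerivAt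
        have h3 : HasFDerivAt (fun z : E × E => (f z.1 * f z.2) • B z) _ (q, q) := h1.smul h2
        rw [h3.fderiv]
        simp [hdiag q hq hqU, hfderiv q hq hqU a ha b hb]
    · refine ⟨0, le_rfl, fun hqs => absurd (Metric.closedBall_subset_closedBall (by linarith) hqs) h,
        fun a _ b _ => ?_⟩
      rw [(hzero (q, q) fun h' => h h'.1).fderiv_eq]
      simp
  · intro q hq p hp
    rw [hdiff q hq p hp.1]
    exact mul_nonpos_of_nonneg_of_nonpos (mul_nonneg f.nonneg f.nonneg) hp.2
  · intro q hq p hp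
    rw [hdiff q hq p hp.1, hp.2, mul_zero]

namespace IsLocalRetraction

variable {O : Set E} {r : E → E}

theorem contDiffOn_comp (h : IsLocalRetraction M O r) (hΦ : ContDiffOn ℝ 2 Φ M) :
    ContDiffOn ℝ 2 (fun q => Φ (r q)) O :=
  hΦ.comp (h.contDiffOn.of_le (by norm_num)) h.mapsTo

theorem fderiv_comp_apply (h : IsLocalRetraction M O r) (hΦ : ContDiffOn ℝ 2 Φ M) {q : E}
    (hq : q ∈ M) (hqO : q ∈ O) (v : E) :
    fderiv ℝ (fun q => Φ (r q)) q v = differential M Φ q (fderiv ℝ r q v) := by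
  have h1 := ((hΦ q hq).differentiableWithinAt (by norm_num)).hasFDerivWithinAt
  rw [← h.eq_self q hq hqO] at h1
  have h2 := (h1.comp q (h.hasFDerivAt hqO).hasFDerivWithinAt h.mapsTo).hasFDerivAt
    (h.mem_nhds hqO)
  rw [HasFDerivAt.fderiv (f := fun q => Φ (r q)) h2, h.eq_self q hq hqO]
  rfl

theorem contDiffOn_field (h : IsLocalRetraction M O r) :
    ContDiffOn ℝ 1 (fun z : E × E => fderiv ℝ r z.1 (z.2 - z.1)) (O ×ˢ O) :=
  ((h.contDiffOn_fderiv.of_le (by norm_num)).comp contDiffOn_fst fun _ hz => hz.1).clm_apply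
    (contDiffOn_snd.sub contDiffOn_fst)

theorem field_mem (h : IsLocalRetraction M O r) {q : E} (hq : q ∈ M) (hqO : q ∈ O) (v : E) :
    fderiv ℝ r q v ∈ tangentSpace M q := by
  have := h.fderiv_mem hqO v
  rwa [h.eq_self q hq hqO] at this

/-- A linearized difference `(q, p) ↦ L(q)(p - q)` has derivative `L(q)(b - a)` on the diagonal. -/
theorem _root_.FinslerChord.hasFDerivAt_clm_sub {E' : Type*} [NormedAddCommGroup E']
    [NormedSpace ℝ E'] {L : E → E →L[ℝ] E'} {q : E} (hL : DifferentiableAt ℝ L q) :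
    HasFDerivAt (fun z : E × E => L z.1 (z.2 - z.1))
      ((L q).comp (ContinuousLinearMap.snd ℝ E E - ContinuousLinearMap.fst ℝ E E)) (q, q) := by
  have h1 : HasFDerivAt (fun z : E × E => L z.1) _ (q, q) :=
    HasFDerivAt.comp (g := L) (q, q) hL.hasFDerivAt hasFDerivAt_fst
  have h2 : HasFDerivAt (fun z : E × E => z.2 - z.1) _ (q, q) :=
    (hasFDerivAt_snd (𝕜 := ℝ) (E := E) (F := E)).sub hasFDerivAt_fst
  exact (h1.clm_apply h2).congr_fderiv (by ext <;> simp)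

/-- The projected difference Dr(q)(p - q) suffices where Φ < 0, as no boundary point lies in this
neighbourhood. -/
theorem exists_isAdmissibleField_interior [FiniteDimensional ℝ E] (h : IsLocalRetraction M O r)
    (hΦ : ContDiffOn ℝ 2 Φ M) {q₀ : E} (hq₀ : q₀ ∈ M) (hq₀O : q₀ ∈ O) (hneg : Φ q₀ < 0) :
    ∃ t ∈ 𝓝 q₀, ∃ A, IsAdmissibleField M Φ t A := by
  have hU : IsOpen (O ∩ (fun q => Φ (r q)) ⁻¹' Iio 0) :=
    (h.contDiffOn_comp hΦ).continuousOn.isOpen_inter_preimage h.isOpen isOpen_Iio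
  refine exists_isAdmissibleField_of_local hU ⟨hq₀O, ?_⟩
    (h.contDiffOn_field.mono (prod_mono inter_subset_left inter_subset_left)) ?_ ?_ ?_ ?_
  · change Φ (r q₀) < 0
    rwa [h.eq_self q₀ hq₀ hq₀O]
  · exact fun q hq hqU p _ _ => h.field_mem hq hqU.1 _
  · simp
  · intro q hq hqU a ha b hb
    rw [(hasFDerivAt_clm_sub (h.hasFDerivAt_fderiv hqU.1).differentiableAt).fderiv]
    simp [h.fderiv_eq_self hqU.1 ha, h.fderiv_eq_self hqU.1 hb]
  · rintro q hq ⟨hqO, hqU⟩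
    have : Φ (r q) < 0 := hqU
    rw [h.eq_self q hq.1 hqO, hq.2] at this
    exact (lt_irrefl _ this).elim

/-- With φ = Φ ∘ r, the projected difference is corrected by R(q,p)Y(q), where Y is tangent with
dφ(Y) = 1 and R is the first-order Taylor remainder of φ. Then dΦ(q)[B(q,p)] = φ(p) - φ(q) = Φ(p)
for q ∈ ∂Ω. Both R and its derivative vanish on the diagonal, so the first-order behaviour is
unchanged; φ of class C² makes R of class C¹. -/
theorem exists_isAdmissibleField_boundary [FiniteDimensional ℝ E] (h : IsLocalRetraction M O r)
    (hΦ : ContDiffOn ℝ 2 Φ M) {q₀ X : E} (hq₀ : q₀ ∈ M) (hq₀O : q₀ ∈ O)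
    (hX : X ∈ tangentSpace M q₀) (hne : differential M Φ q₀ X ≠ 0) :
    ∃ t ∈ 𝓝 q₀, ∃ A, IsAdmissibleField M Φ t A := by
  set φ := fun q => Φ (r q) with hφ
  have hφc : ContDiffOn ℝ 2 φ O := h.contDiffOn_comp hΦ
  have hφr : ∀ q ∈ M, q ∈ O → φ q = Φ q := fun q hq hqO => by
    simp only [hφ, h.eq_self q hq hqO]
  have hdφ : ContDiffOn ℝ 1 (fderiv ℝ φ) O := hφc.fderiv_of_isOpen h.isOpen (by norm_num)
  have hdX : ContDiffOn ℝ 1 (fun q => fderiv ℝ φ q X) O := hdφ.clm_apply contDiffOn_const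
  set U := O ∩ (fun q => fderiv ℝ φ q X) ⁻¹' {0}ᶜ with hUdef
  have hU : IsOpen U := hdX.continuousOn.isOpen_inter_preimage h.isOpen isOpen_compl_singleton
  set Y : E → E := fun q => (fderiv ℝ φ q X)⁻¹ • fderiv ℝ r q X with hY
  have hYc : ContDiffOn ℝ 1 Y U :=
    ((hdX.mono inter_subset_left).inv fun q hq => hq.2).smul
      (((h.contDiffOn_fderiv.of_le (by norm_num)).mono inter_subset_left).clm_apply
        contDiffOn_const)
  set R : E × E → ℝ := fun z => φ z.2 - φ z.1 - fderiv ℝ φ z.1 (z.2 - z.1) with hR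
  have hRc : ContDiffOn ℝ 1 R (O ×ˢ O) :=
    (((hφc.of_le (by norm_num)).comp contDiffOn_snd fun _ hz => hz.2).sub
      ((hφc.of_le (by norm_num)).comp contDiffOn_fst fun _ hz => hz.1)).sub
      ((hdφ.comp contDiffOn_fst fun _ hz => hz.1).clm_apply (contDiffOn_snd.sub contDiffOn_fst))
  have hR0 : ∀ q : E, R (q, q) = 0 := fun q => by simp [hR]
  have hRd : ∀ q ∈ O, HasFDerivAt R (0 : E × E →L[ℝ] ℝ) (q, q) := by
    intro q hq
    have h1 : HasFDerivAt φ (fderiv ℝ φ q) q :=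
      ((hφc.contDiffAt (h.mem_nhds hq)).differentiableAt (by norm_num)).hasFDerivAt
    have h2 : DifferentiableAt ℝ (fderiv ℝ φ) q :=
      (hdφ.contDiffAt (h.mem_nhds hq)).differentiableAt (by norm_num)
    have h3 : HasFDerivAt (fun z : E × E => φ z.2) _ (q, q) :=
      HasFDerivAt.comp (g := φ) (q, q) h1 hasFDerivAt_snd
    have h4 : HasFDerivAt (fun z : E × E => φ z.1) _ (q, q) :=
      HasFDerivAt.comp (g := φ) (q, q) h1 hasFDerivAt_fst
    exact ((h3.sub h4).sub (hasFDerivAt_clm_sub h2)).congr_fderiv (by ext <;> simp)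
  have hUO : U ×ˢ U ⊆ O ×ˢ O := prod_mono inter_subset_left inter_subset_left
  refine exists_isAdmissibleField_of_local hU (q₀ := q₀) ⟨hq₀O, ?_⟩
    (B := fun z => fderiv ℝ r z.1 (z.2 - z.1) + R z • Y z.1)
    ((h.contDiffOn_field.mono hUO).add ((hRc.mono hUO).smul
      (hYc.comp contDiffOn_fst fun _ hz => hz.1))) ?_ ?_ ?_ ?_
  · change fderiv ℝ φ q₀ X ≠ 0
    rwa [h.fderiv_comp_apply hΦ hq₀ hq₀O, h.fderiv_eq_self hq₀O hX]
  · intro q hq hqU p _ _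
    have : fderiv ℝ r q (p - q) + R (q, p) • Y q =
        fderiv ℝ r q (p - q + R (q, p) • (fderiv ℝ φ q X)⁻¹ • X) := by
      simp [hY]
    simp only [this]
    exact h.field_mem hq hqU.1 _
  · intro q _ _
    simp [hR0]
  · intro q hq hqU a ha b hb
    have h1 : HasFDerivAt (fun z : E × E => Y z.1) _ (q, q) :=
      HasFDerivAt.comp (g := Y) (q, q) ((hYc.contDiffAt (hU.mem_nhds hqU)).differentiableAt
        (by norm_num)).hasFDerivAt hasFDerivAt_fst
    have h2 : HasFDerivAt (fun z : E × E => fderiv ℝ r z.1 (z.2 - z.1) + R z • Y z.1) _ (q, q) :=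
      (hasFDerivAt_clm_sub (h.hasFDerivAt_fderiv hqU.1).differentiableAt).add
      ((hRd q hqU.1).smul h1)
    rw [h2.fderiv]
    simp [h.fderiv_eq_self hqU.1 ha, h.fderiv_eq_self hqU.1 hb, hR0]
  · intro q hq hqU p hp hpU
    -- Writing the field as a value of Dr(q) allows dΦ to be replaced by dφ.
    have : fderiv ℝ r q (p - q) + R (q, p) • Y q =
        fderiv ℝ r q (p - q + R (q, p) • (fderiv ℝ φ q X)⁻¹ • X) := by
      simp [hY]
    simp only [this]
    rw [← h.fderiv_comp_apply hΦ hq.1 hqU.1, map_add, map_smul, map_smul, smul_eq_mul, smul_eq_mul,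
      inv_mul_cancel₀ hqU.2]
    simp only [hR, mul_one, hφr p hp hpU.1, hφr q hq.1 hqU.1, hq.2]
    ring

end IsLocalRetraction

/-- Induction over a finite cover of Ω̄: fields exist near each point, and sums have ρ > 0 on
unions. -/
theorem exists_isAdmissibleField [FiniteDimensional ℝ E] (hM : HasLocalRetractions M) {N : ℕ}
    (hΦ : IsDiskFunction N M Φ) : ∃ A, IsAdmissibleField M Φ (closedDomain M Φ) A := by
  refine hΦ.isCompact.induction_on (p := fun s => ∃ A, IsAdmissibleField M Φ s A)
    ⟨0, isAdmissibleField_empty M Φ⟩ ?_ ?_ ?_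
  · rintro s t hst ⟨A, hA⟩
    exact ⟨A, hA.mono hst⟩
  · rintro s t ⟨A, hA⟩ ⟨B, hB⟩
    exact ⟨A + B, hA.add hM hB⟩
  · intro q hq
    obtain ⟨O, r, hO, h⟩ := hM q hq.1
    have : ∃ t ∈ 𝓝 q, ∃ A, IsAdmissibleField M Φ t A := by
      rcases hq.2.lt_or_eq with hlt | heq
      · exact h.exists_isAdmissibleField_interior hΦ.contDiffOn hq.1 hO hlt
      · obtain ⟨X, hX, hne⟩ := hΦ.regular q ⟨hq.1, heq⟩
        exact h.exists_isAdmissibleField_boundary hΦ.contDiffOn hq.1 hO hX hne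
    obtain ⟨t, ht, hA⟩ := this
    exact ⟨t, nhdsWithin_le_nhds ht, hA⟩

end AdmissibleField

/-! ### Absolutely continuous curves and L² derivatives -/

section Sobolev

theorem _root_.AbsolutelyContinuousOnInterval.of_dist_le {X Y : Type*} [PseudoMetricSpace X]
    [PseudoMetricSpace Y] {f : ℝ → X} {g : ℝ → Y} {a b : ℝ}
    (hg : AbsolutelyContinuousOnInterval g a b)
    (h : ∀ s ∈ uIcc a b, ∀ t ∈ uIcc a b, dist (f s) (f t) ≤ dist (g s) (g t)) :
    AbsolutelyContinuousOnInterval f a b := by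
  refine squeeze_zero' (Eventually.of_forall fun _ => Finset.sum_nonneg fun _ _ => dist_nonneg)
    ?_ hg
  filter_upwards [mem_inf_of_right (mem_principal_self _)] with I hI
  exact Finset.sum_le_sum fun i hi => h _ (hI.1 i hi).1 _ (hI.1 i hi).2

variable {E : Type*} [NormedAddCommGroup E] [NormedSpace ℝ E]

omit [NormedSpace ℝ E] in
theorem _root_.AbsolutelyContinuousOnInterval.prodMk {E' : Type*} [NormedAddCommGroup E']
    {f : ℝ → E} {g : ℝ → E'} {a b : ℝ}
    (hf : AbsolutelyContinuousOnInterval f a b) (hg : AbsolutelyContinuousOnInterval g a b) :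
    AbsolutelyContinuousOnInterval (fun s => (f s, g s)) a b := by
  have h : Tendsto (fun I : ℕ × (ℕ → ℝ × ℝ) =>
      ∑ i ∈ Finset.range I.1, dist (f (I.2 i).1) (f (I.2 i).2) +
        ∑ i ∈ Finset.range I.1, dist (g (I.2 i).1) (g (I.2 i).2))
      (AbsolutelyContinuousOnInterval.totalLengthFilter ⊓
        𝓟 (AbsolutelyContinuousOnInterval.disjWithin a b)) (𝓝 (0 + 0)) := Filter.Tendsto.add hf hg
  rw [add_zero] at h
  refine squeeze_zero (fun _ => Finset.sum_nonneg fun _ _ => dist_nonneg) (fun I => ?_) h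
  rw [← Finset.sum_add_distrib]
  refine Finset.sum_le_sum fun i _ => ?_
  rw [Prod.dist_eq]
  exact max_le_add_of_nonneg dist_nonneg dist_nonneg

theorem _root_.AbsolutelyContinuousOnInterval.comp_contDiff {E₁ E₂ : Type*}
    [NormedAddCommGroup E₁] [NormedSpace ℝ E₁] [FiniteDimensional ℝ E₁] [NormedAddCommGroup E₂]
    [NormedSpace ℝ E₂] {A : E₁ → E₂} (hA : ContDiff ℝ 1 A) {f : ℝ → E₁} {a b : ℝ}
    (hf : AbsolutelyContinuousOnInterval f a b) :
    AbsolutelyContinuousOnInterval (fun s => A (f s)) a b := by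
  obtain ⟨C, hC⟩ := hf.exists_bound
  obtain ⟨L, hL⟩ := hA.contDiffOn.exists_lipschitzOnWith one_ne_zero
    (convex_closedBall (0 : E₁) C) (isCompact_closedBall _ _)
  refine (hf.const_smul (L : ℝ)).of_dist_le fun s hs t ht => ?_
  rw [dist_smul₀]
  simpa using hL.dist_le_mul _ (by simpa using hC s hs) _ (by simpa using hC t ht)

theorem intervalIntegral_eq_integral_Icc (f : ℝ → E) :
    ∫ s in (0 : ℝ)..1, f s = ∫ s in Icc (0 : ℝ) 1, f s := by
  rw [intervalIntegral.integral_of_le zero_le_one, integral_Icc_eq_integral_Ioc]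

theorem ae_mem_Ioo : ∀ᵐ s ∂(volume.restrict (Icc (0 : ℝ) 1)), s ∈ Ioo (0 : ℝ) 1 := by
  rw [Measure.restrict_congr_set Ioo_ae_eq_Icc.symm]
  exact ae_restrict_mem measurableSet_Ioo

omit [NormedSpace ℝ E] in
theorem _root_.MeasureTheory.MemLp.intervalIntegrable_of_two {g : ℝ → E}
    (hg : MemLp g 2 (volume.restrict (Icc (0 : ℝ) 1))) {s t : ℝ} (hs : s ∈ Icc (0 : ℝ) 1)
    (ht : t ∈ Icc (0 : ℝ) 1) : IntervalIntegrable g volume s t := by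
  rw [intervalIntegrable_iff]
  exact IntegrableOn.mono_set (hg.integrable one_le_two)
    (uIoc_subset_uIcc.trans (uIcc_subset_Icc hs ht))

theorem IsH1.ae_hasDerivAt [FiniteDimensional ℝ E] {x : ℝ → E} (hx : IsH1 x) :
    ∀ᵐ s ∂(volume.restrict (Icc (0 : ℝ) 1)), HasDerivAt x (deriv x s) s := by
  have h := hx.1.boundedVariationOn.ae_differentiableAt_of_mem_uIcc
  rw [uIcc_of_le zero_le_one] at h
  rw [ae_restrict_iff' measurableSet_Icc]
  filter_upwards [h] with s hs hs1 using (hs hs1).hasDerivAt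

theorem absolutelyContinuousOnInterval_integral {g : ℝ → E}
    (hg : MemLp g 2 (volume.restrict (Icc (0 : ℝ) 1))) :
    AbsolutelyContinuousOnInterval (fun s => ∫ t in (0 : ℝ)..s, g t) 0 1 := by
  have h0 : (0 : ℝ) ∈ Icc (0 : ℝ) 1 := by simp
  have h1 : (1 : ℝ) ∈ Icc (0 : ℝ) 1 := by simp
  refine ((hg.intervalIntegrable_of_two h0 h1).norm.absolutelyContinuousOnInterval_intervalIntegral
    (c := 0) (by simp)).of_dist_le fun s hs t ht => ?_
  rw [uIcc_of_le zero_le_one] at hs ht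
  rw [dist_comm, dist_comm (∫ v in (0 : ℝ)..s, ‖g v‖), dist_eq_norm, dist_eq_norm,
    intervalIntegral.integral_interval_sub_left (hg.intervalIntegrable_of_two h0 ht)
      (hg.intervalIntegrable_of_two h0 hs),
    intervalIntegral.integral_interval_sub_left (hg.intervalIntegrable_of_two h0 ht).norm
      (hg.intervalIntegrable_of_two h0 hs).norm]
  exact intervalIntegral.norm_integral_le_abs_integral_norm

theorem ae_hasDerivAt_integral_Icc [CompleteSpace E] {g : ℝ → E}
    (hg : MemLp g 2 (volume.restrict (Icc (0 : ℝ) 1))) :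
    ∀ᵐ s ∂(volume.restrict (Icc (0 : ℝ) 1)), HasDerivAt (fun s => ∫ t in (0 : ℝ)..s, g t) (g s) s := by
  have h := (hg.intervalIntegrable_of_two (s := 0) (t := 1) (by simp)
    (by simp)).ae_hasDerivAt_integral
  rw [uIcc_of_le zero_le_one] at h
  rw [ae_restrict_iff' measurableSet_Icc]
  filter_upwards [h] with s hs hs1 using hs hs1 0 (by simp)

theorem isH1_integral [CompleteSpace E] {g : ℝ → E}
    (hg : MemLp g 2 (volume.restrict (Icc (0 : ℝ) 1))) (v : E) :
    IsH1 (fun s => v + ∫ t in (0 : ℝ)..s, g t) ∧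
      deriv (fun s => v + ∫ t in (0 : ℝ)..s, g t) =ᵐ[volume.restrict (Icc (0 : ℝ) 1)] g := by
  have h : deriv (fun s => v + ∫ t in (0 : ℝ)..s, g t) =ᵐ[volume.restrict (Icc (0 : ℝ) 1)] g := by
    filter_upwards [ae_hasDerivAt_integral_Icc hg] with s hs
    exact (hs.const_add v).deriv
  refine ⟨⟨(absolutelyContinuousOnInterval_integral hg).of_dist_le fun s _ t _ => ?_,
    (memLp_congr_ae h).2 hg⟩, h⟩
  simp [dist_add_left]

/-- The difference between x and the primitive of its derivative is absolutely continuous with zero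
derivative almost everywhere, hence constant. -/
theorem IsH1.sub_eq_integral [FiniteDimensional ℝ E] {x : ℝ → E} (hx : IsH1 x) {s t : ℝ}
    (hs : s ∈ Icc (0 : ℝ) 1) (ht : t ∈ Icc (0 : ℝ) 1) :
    x t - x s = ∫ v in s..t, deriv x v := by
  have : CompleteSpace E := FiniteDimensional.complete ℝ E
  have h0 : (0 : ℝ) ∈ Icc (0 : ℝ) 1 := by simp
  have hac := hx.1.fun_sub (absolutelyContinuousOnInterval_integral hx.2)
  have hd : ∀ᵐ s, s ∈ uIcc (0 : ℝ) 1 →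
      HasDerivAt (fun s => x s - ∫ t in (0 : ℝ)..s, deriv x t) 0 s := by
    rw [uIcc_of_le zero_le_one, ← ae_restrict_iff' measurableSet_Icc]
    filter_upwards [hx.ae_hasDerivAt, ae_hasDerivAt_integral_Icc hx.2] with s h1 h2
    simpa using h1.fun_sub h2
  obtain ⟨C, hC⟩ := hac.const_of_ae_hasDerivAt_zero hd
  rw [uIcc_of_le zero_le_one] at hC
  rw [← intervalIntegral.integral_interval_sub_left (hx.2.intervalIntegrable_of_two h0 ht)
    (hx.2.intervalIntegrable_of_two h0 hs)]
  have h1 := hC s hs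
  have h2 := hC t ht
  rw [sub_eq_iff_eq_add] at h1 h2
  rw [h1, h2]; abel

omit [NormedSpace ℝ E] in
theorem _root_.MeasureTheory.MemLp.integrable_norm_sq {α : Type*} {m : MeasurableSpace α}
    {μ : Measure α} {g : α → E} (hg : MemLp g 2 μ) : Integrable (fun s => ‖g s‖ ^ 2) μ :=
  (memLp_two_iff_integrable_sq_norm hg.1).1 hg

/-- A form of Hölder continuity with exponent `1/2`. -/
theorem IsH1.norm_sub_le [FiniteDimensional ℝ E] {x : ℝ → E} (hx : IsH1 x) {s t l : ℝ}
    (hs : s ∈ Icc (0 : ℝ) 1) (ht : t ∈ Icc (0 : ℝ) 1) (hl : 0 < l) :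
    ‖x t - x s‖ ≤ l * |t - s| + l⁻¹ * ∫ v in Icc (0 : ℝ) 1, ‖deriv x v‖ ^ 2 := by
  wlog hst : s ≤ t generalizing s t
  · rw [norm_sub_rev, abs_sub_comm]
    exact this ht hs (le_of_not_ge hst)
  have hi := hx.2.intervalIntegrable_of_two hs ht
  have hsub : Ioc s t ⊆ Icc (0 : ℝ) 1 := fun v hv => ⟨hs.1.trans hv.1.le, hv.2.trans ht.2⟩
  have hi2 : IntegrableOn (fun v => ‖deriv x v‖ ^ 2) (Ioc s t) :=
    IntegrableOn.mono_set hx.2.integrable_norm_sq hsub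
  rw [hx.sub_eq_integral hs ht]
  calc ‖∫ v in s..t, deriv x v‖ ≤ ∫ v in s..t, ‖deriv x v‖ :=
        intervalIntegral.norm_integral_le_integral_norm hst
    _ = ∫ v in Ioc s t, ‖deriv x v‖ := intervalIntegral.integral_of_le hst
    _ ≤ ∫ v in Ioc s t, (l + l⁻¹ * ‖deriv x v‖ ^ 2) := by
        refine integral_mono ((intervalIntegrable_iff_integrableOn_Ioc_of_le hst).1 hi).norm
          ((integrable_const _).add (hi2.const_mul _)) fun v => ?_
        -- Young's inequality with a free parameter l replaces Cauchy–Schwarz and avoids square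
        -- roots.
        have h1 : l * ‖deriv x v‖ ≤ l * (l + l⁻¹ * ‖deriv x v‖ ^ 2) := by
          rw [mul_add, mul_inv_cancel_left₀ hl.ne']
          nlinarith [sq_nonneg (l - ‖deriv x v‖), sq_nonneg (l + ‖deriv x v‖)]
        exact le_of_mul_le_mul_left h1 hl
    _ = l * |t - s| + l⁻¹ * ∫ v in Ioc s t, ‖deriv x v‖ ^ 2 := by
        rw [integral_add (integrable_const _) (hi2.const_mul _), integral_const_mul]
        simp [abs_of_nonneg (sub_nonneg.2 hst), hst, mul_comm]
    _ ≤ l * |t - s| + l⁻¹ * ∫ v in Icc (0 : ℝ) 1, ‖deriv x v‖ ^ 2 := by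
        gcongr
        · exact Eventually.of_forall fun _ => by positivity
        · exact hx.2.integrable_norm_sq

theorem IsH1.sub {x y : ℝ → E} [FiniteDimensional ℝ E] (hx : IsH1 x) (hy : IsH1 y) :
    IsH1 (fun s => x s - y s) ∧ deriv (fun s => x s - y s)
      =ᵐ[volume.restrict (Icc (0 : ℝ) 1)] fun s => deriv x s - deriv y s := by
  have h : deriv (fun s => x s - y s)
      =ᵐ[volume.restrict (Icc (0 : ℝ) 1)] fun s => deriv x s - deriv y s := by
    filter_upwards [hx.ae_hasDerivAt, hy.ae_hasDerivAt] with s h1 h2 using (h1.fun_sub h2).deriv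
  exact ⟨⟨hx.1.fun_sub hy.1, (memLp_congr_ae h).2 (hx.2.sub hy.2)⟩, h⟩

omit [NormedSpace ℝ E] in
theorem norm_toLp_sq {α : Type*} {m : MeasurableSpace α} {μ : Measure α} {g : α → E}
    (hg : MemLp g 2 μ) : ‖hg.toLp g‖ ^ 2 = ∫ s, ‖g s‖ ^ 2 ∂μ := by
  rw [Lp.norm_toLp, hg.eLpNorm_eq_integral_rpow_norm two_ne_zero ENNReal.ofNat_ne_top,
    ENNReal.toReal_ofReal (by positivity), ← Real.rpow_natCast, ← Real.rpow_mul (by positivity)]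
  simp

omit [NormedSpace ℝ E] in
/-- Completeness of `L²`. -/
theorem exists_memLp_tendsto_integral_norm_sub_sq [CompleteSpace E] {α : Type*}
    {m : MeasurableSpace α} {μ : Measure α} {f : ℕ → α → E} (hf : ∀ n, MemLp (f n) 2 μ)
    (hc : ∀ ε > 0, ∃ N, ∀ n ≥ N, ∀ m ≥ N, ∫ s, ‖f n s - f m s‖ ^ 2 ∂μ ≤ ε) :
    ∃ g, MemLp g 2 μ ∧ Tendsto (fun n => ∫ s, ‖f n s - g s‖ ^ 2 ∂μ) atTop (𝓝 0) := by
  have hcs : CauchySeq fun n => (hf n).toLp (f n) := by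
    refine Metric.cauchySeq_iff.2 fun ε hε => ?_
    obtain ⟨N, hN⟩ := hc ((ε / 2) ^ 2) (by positivity)
    refine ⟨N, fun n hn m hm => ?_⟩
    have h1 : ‖((hf n).sub (hf m)).toLp‖ ^ 2 ≤ (ε / 2) ^ 2 := by
      rw [norm_toLp_sq]; exact hN n hn m hm
    rw [dist_eq_norm, ← MemLp.toLp_sub]
    linarith [abs_le_of_sq_le_sq h1 (by positivity), le_abs_self ‖((hf n).sub (hf m)).toLp‖]
  obtain ⟨g, hg⟩ := cauchySeq_tendsto_of_complete hcs
  refine ⟨g, Lp.memLp g, ?_⟩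
  have h1 : ∀ n, ∫ s, ‖f n s - g s‖ ^ 2 ∂μ = ‖(hf n).toLp (f n) - g‖ ^ 2 := fun n => by
    have h2 := norm_toLp_sq ((hf n).sub (Lp.memLp g))
    rw [MemLp.toLp_sub (hf n) (Lp.memLp g), Lp.toLp_coeFn] at h2
    exact h2.symm
  simp only [h1]
  have := (tendsto_iff_norm_sub_tendsto_zero.1 hg).pow 2
  simpa using this

/-- Changing g on a null set makes it take all its values in S, where f is continuous; S itself need
not be measurable. -/
theorem aestronglyMeasurable_comp_continuousOn {α X : Type*} [TopologicalSpace X]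
    [MeasurableSpace X] [BorelSpace X] {m : MeasurableSpace α} {μ : Measure α}
    {f : X → ℝ} {S : Set X} (hf : ContinuousOn f S) {g : α → X} (hg : AEMeasurable g μ)
    (hS : ∀ᵐ a ∂μ, g a ∈ S) : AEStronglyMeasurable (fun a => f (g a)) μ := by
  rcases S.eq_empty_or_nonempty with rfl | hne
  · have : μ = 0 := by simpa using hS
    rw [this]
    exact aestronglyMeasurable_zero_measure _
  obtain ⟨k, hk, hkS, hgk⟩ := hg.exists_ae_eq_range_subset hS hne
  have h1 : Measurable fun a => S.domRestrict f ⟨k a, hkS (mem_range_self a)⟩ :=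
    hf.domRestrict.measurable.comp hk.subtype_mk
  refine (h1.aestronglyMeasurable (μ := μ)).congr ?_
  filter_upwards [hgk] with a ha
  rw [ha]; rfl

end Sobolev

/-! ### Energy bounds and admissible test variations -/

section PalaisSmale

variable {E : Type*} [NormedAddCommGroup E] [NormedSpace ℝ E] {M : Set E} {F : E × E → ℝ}
  {Φ : E → ℝ} {x y : ℝ → E}

theorem ae_mem_tangentBundle [FiniteDimensional ℝ E] (hx : x ∈ curveSpace M Φ) :
    ∀ᵐ s ∂(volume.restrict (Icc (0 : ℝ) 1)),
      (x s, deriv x s) ∈ tangentBundle M ∧ x s ∈ closedDomain M Φ := by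
  filter_upwards [hx.1.ae_hasDerivAt, ae_mem_Ioo] with s hs hs1
  have hs2 := hx.2.1 s (Ioo_subset_Icc_self hs1)
  refine ⟨⟨hs2.1, mem_tangentSpace_of_hasDerivAt hs ?_⟩, hs2⟩
  filter_upwards [Ioo_mem_nhds hs1.1 hs1.2] with t ht
  exact (hx.2.1 t (Ioo_subset_Icc_self ht)).1

theorem ae_mem_tangentPairs [FiniteDimensional ℝ E] (hx : x ∈ curveSpace M Φ)
    (hy : y ∈ curveSpace M Φ) : ∀ᵐ s ∂(volume.restrict (Icc (0 : ℝ) 1)),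
      ((x s, y s), (deriv x s, deriv y s)) ∈ tangentPairs M (closedDomain M Φ) := by
  filter_upwards [ae_mem_tangentBundle hx, ae_mem_tangentBundle hy] with s h1 h2 using ⟨h1, h2⟩

theorem IsH1.aemeasurable [MeasurableSpace E] [BorelSpace E] (hx : IsH1 x) :
    AEMeasurable x (volume.restrict (Icc (0 : ℝ) 1)) := by
  have := hx.1.continuousOn
  rw [uIcc_of_le zero_le_one] at this
  exact this.aemeasurable measurableSet_Icc

theorem IsFinslerMetric.integral_norm_sq_le [FiniteDimensional ℝ E]
    (hF : IsFinslerMetric M F) (hM : HasLocalRetractions M)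
    (hK : IsCompact (closedDomain M Φ)) :
    ∃ m > 0, ∀ x ∈ curveSpace M Φ,
      m * ∫ s in Icc (0 : ℝ) 1, ‖deriv x s‖ ^ 2 ≤ 2 * energy F x := by
  borelize E
  have hKM : closedDomain M Φ ⊆ M := fun _ h => h.1
  obtain ⟨m, hm, hmF⟩ := hF.exists_le_sq hM hK hKM
  obtain ⟨C, hC0, hC⟩ := hF.exists_sq_le hM hK hKM
  refine ⟨m, hm, fun x hx => ?_⟩
  have hi : Integrable (fun s => F (x s, deriv x s) ^ 2) (volume.restrict (Icc (0 : ℝ) 1)) := by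
    refine (hx.1.2.integrable_norm_sq.const_mul C).mono' ?_ ?_
    · refine aestronglyMeasurable_comp_continuousOn (f := fun z => F z ^ 2)
        (hF.continuousOn.pow 2) (hx.1.aemeasurable.prodMk hx.1.2.1.aemeasurable) ?_
      filter_upwards [ae_mem_tangentBundle hx] with s hs using hs.1
    · filter_upwards [ae_mem_tangentBundle hx] with s hs
      rw [Real.norm_of_nonneg (sq_nonneg _)]
      exact hC _ hs.1 hs.2
  rw [energy, intervalIntegral_eq_integral_Icc, ← integral_const_mul]
  have := integral_mono_ae (hx.1.2.integrable_norm_sq.const_mul m) hi (by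
    filter_upwards [ae_mem_tangentBundle hx] with s hs using hmF _ hs.1 hs.2)
  linarith

namespace IsAdmissibleField

variable {A : E × E → E} [FiniteDimensional ℝ E]

theorem ae_deriv_comp (hA : ContDiff ℝ 1 A) (hx : IsH1 x) (hy : IsH1 y) :
    ∀ᵐ s ∂(volume.restrict (Icc (0 : ℝ) 1)), deriv (fun s => A (x s, y s)) s =
      fderiv ℝ A (x s, y s) (deriv x s, deriv y s) := by
  filter_upwards [hx.ae_hasDerivAt, hy.ae_hasDerivAt] with s h1 h2
  have h3 := (hA.differentiable one_ne_zero (x s, y s)).hasFDerivAt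
  exact (HasFDerivAt.comp_hasDerivAt (f := fun s => (x s, y s)) s h3 (h1.prodMk h2)).deriv

theorem exists_norm_deriv_sq_le (hA : ContDiff ℝ 1 A) (hK : IsCompact (closedDomain M Φ)) :
    ∃ L : ℝ, 0 ≤ L ∧ ∀ x ∈ curveSpace M Φ, ∀ y ∈ curveSpace M Φ,
      ∀ᵐ s ∂(volume.restrict (Icc (0 : ℝ) 1)), ‖deriv (fun s => A (x s, y s)) s‖ ^ 2 ≤
        L * (‖deriv x s‖ ^ 2 + ‖deriv y s‖ ^ 2) := by
  obtain ⟨L, hL⟩ := (hK.prod hK).exists_bound_of_continuousOn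
    (hA.continuous_fderiv one_ne_zero).continuousOn
  refine ⟨L ^ 2, sq_nonneg _, fun x hx y hy => ?_⟩
  filter_upwards [ae_deriv_comp hA hx.1 hy.1, ae_mem_tangentPairs hx hy] with s h1 h2
  have h3 : ‖(deriv x s, deriv y s)‖ ^ 2 ≤ ‖deriv x s‖ ^ 2 + ‖deriv y s‖ ^ 2 := by
    rcases max_choice ‖deriv x s‖ ‖deriv y s‖ with h | h <;> rw [Prod.norm_mk, h] <;>
      linarith [sq_nonneg ‖deriv x s‖, sq_nonneg ‖deriv y s‖]
  calc ‖deriv (fun s => A (x s, y s)) s‖ ^ 2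
      ≤ (L * ‖(deriv x s, deriv y s)‖) ^ 2 := by
        rw [h1]
        gcongr
        exact ContinuousLinearMap.le_of_opNorm_le _ (hL _ ⟨h2.1.2, h2.2.2⟩) _
    _ ≤ L ^ 2 * (‖deriv x s‖ ^ 2 + ‖deriv y s‖ ^ 2) := by
        rw [mul_pow]; gcongr

theorem isH1_comp (hA : ContDiff ℝ 1 A) (hK : IsCompact (closedDomain M Φ))
    (hx : x ∈ curveSpace M Φ) (hy : y ∈ curveSpace M Φ) : IsH1 fun s => A (x s, y s) := by
  borelize E
  obtain ⟨L, -, hL⟩ := exists_norm_deriv_sq_le hA hK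
  refine ⟨(hx.1.1.prodMk hy.1.1).comp_contDiff hA, ?_⟩
  have hm := aestronglyMeasurable_deriv (fun s => A (x s, y s)) (volume.restrict (Icc (0 : ℝ) 1))
  rw [memLp_two_iff_integrable_sq_norm hm]
  refine ((hx.1.2.integrable_norm_sq.add hy.1.2.integrable_norm_sq).const_mul L).mono'
    (hm.norm.pow 2) ?_
  filter_upwards [hL x hx y hy] with s hs
  rw [Real.norm_of_nonneg (sq_nonneg _)]
  exact hs

/-- Contacts of x with ∂Ω are harmless wherever y is, since y stays in Ω̄; the endpoint equalities
hold because both curves end on ∂Ω. -/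
theorem mem_admissibleVariations (hA : IsAdmissibleField M Φ (closedDomain M Φ) A)
    (hK : IsCompact (closedDomain M Φ)) (hx : x ∈ curveSpace M Φ) (hy : y ∈ curveSpace M Φ) :
    (fun s => A (x s, y s)) ∈ admissibleVariations M Φ x :=
  ⟨isH1_comp hA.contDiff hK hx hy,
    fun s hs => hA.mem_tangentSpace _ (hx.2.1 s hs).1 _ (hy.2.1 s hs).1,
    hA.eq_zero _ hx.2.2.1 _ hy.2.2.1, hA.eq_zero _ hx.2.2.2 _ hy.2.2.2,
    fun s hs hxs => hA.nonpos _ hxs _ (hy.2.1 s (Ioo_subset_Icc_self hs))⟩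

theorem exists_starNorm_le (hA : ContDiff ℝ 1 A) (hK : IsCompact (closedDomain M Φ)) (B : ℝ) :
    ∃ S : ℝ, ∀ x ∈ curveSpace M Φ, ∀ y ∈ curveSpace M Φ,
      ∫ s in Icc (0 : ℝ) 1, ‖deriv x s‖ ^ 2 ≤ B → ∫ s in Icc (0 : ℝ) 1, ‖deriv y s‖ ^ 2 ≤ B →
        starNorm (fun s => A (x s, y s)) ≤ S := by
  obtain ⟨L, hL0, hL⟩ := exists_norm_deriv_sq_le hA hK
  obtain ⟨C, hC⟩ := (hK.prod hK).exists_bound_of_continuousOn hA.continuous.continuousOn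
  refine ⟨C + √(L * (B + B)), fun x hx y hy hxB hyB => add_le_add ?_ (Real.sqrt_le_sqrt ?_)⟩
  · exact max_le (hC _ ⟨hx.2.1 0 (by simp), hy.2.1 0 (by simp)⟩)
      (hC _ ⟨hx.2.1 1 (by simp), hy.2.1 1 (by simp)⟩)
  · rw [intervalIntegral_eq_integral_Icc]
    refine (integral_mono_ae (isH1_comp hA hK hx hy).2.integrable_norm_sq
      ((hx.1.2.integrable_norm_sq.add hy.1.2.integrable_norm_sq).const_mul L)
      (hL x hx y hy)).trans ?_
    rw [integral_const_mul]
    gcongr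
    simp only [Pi.add_apply]
    rw [integral_add hx.1.2.integrable_norm_sq hy.1.2.integrable_norm_sq]
    exact add_le_add hxB hyB

theorem integrable_energyPairing (hF : IsFinslerMetric M F) (hM : HasLocalRetractions M)
    (hA : IsAdmissibleField M Φ (closedDomain M Φ) A)
    (hK : IsCompact (closedDomain M Φ)) (hx : x ∈ curveSpace M Φ) (hy : y ∈ curveSpace M Φ) :
    Integrable (fun s => energyPairing M F A ((x s, y s), (deriv x s, deriv y s)))
      (volume.restrict (Icc (0 : ℝ) 1)) := by
  borelize E
  obtain ⟨C, hC⟩ := hF.exists_energyPairing_le hM hK (fun _ h => h.1) hA.contDiff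
    hA.mem_tangentSpace
  refine ((hx.1.2.integrable_norm_sq.add hy.1.2.integrable_norm_sq).const_mul C).mono' ?_ ?_
  · exact aestronglyMeasurable_comp_continuousOn
      (hF.continuousOn_energyPairing hM hA.contDiff hA.mem_tangentSpace)
      ((hx.1.aemeasurable.prodMk hy.1.aemeasurable).prodMk
        (hx.1.2.1.aemeasurable.prodMk hy.1.2.1.aemeasurable)) (ae_mem_tangentPairs hx hy)
  · filter_upwards [ae_mem_tangentPairs hx hy] with s hs using hC _ hs

theorem energyDifferential_eq (hA : ContDiff ℝ 1 A) (hx : IsH1 x) (hy : IsH1 y) :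
    energyDifferential M F x (fun s => A (x s, y s)) =
      (1 / 2) * ∫ s in Icc (0 : ℝ) 1,
        energyPairing M F A ((x s, y s), (deriv x s, deriv y s)) := by
  rw [energyDifferential, intervalIntegral_eq_integral_Icc]
  congr 1
  refine integral_congr_ae ?_
  filter_upwards [ae_deriv_comp hA hx hy] with s hs
  rw [hs]; rfl

end IsAdmissibleField

/-- Normalization of V, admissible variations being stable under positive scaling. If the norm is
zero, then V vanishes on [0,1] and so does the differential. -/
theorem le_energyDifferential [FiniteDimensional ℝ E] {ε : ℝ}
    (h : ∀ V ∈ admissibleVariations M Φ x, starNorm V = 1 → -ε ≤ energyDifferential M F x V)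
    {V : ℝ → E} (hV : V ∈ admissibleVariations M Φ x) :
    -ε * starNorm V ≤ energyDifferential M F x V := by
  have hdiff : ∀ z : E × E, ∀ ζ : E × E, ∀ a : ℝ,
      differential (tangentBundle M) (fun p => F p ^ 2) z (a • ζ) =
        a * differential (tangentBundle M) (fun p => F p ^ 2) z ζ := fun z ζ a => map_smul _ _ _
  have hdΦ : ∀ q v : E, ∀ a : ℝ, differential M Φ q (a • v) = a * differential M Φ q v :=
    fun q v a => map_smul _ _ _
  have hn : 0 ≤ starNorm V := add_nonneg (le_max_of_le_left (norm_nonneg _)) (Real.sqrt_nonneg _)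
  rcases hn.eq_or_lt with h0 | hpos
  · have h1 : max ‖V 0‖ ‖V 1‖ = 0 ∧ √(∫ s in (0 : ℝ)..1, ‖deriv V s‖ ^ 2) = 0 := by
      refine (add_eq_zero_iff_of_nonneg (le_max_of_le_left (norm_nonneg _))
        (Real.sqrt_nonneg _)).1 h0.symm
    have hV0 : V 0 = 0 := norm_le_zero_iff.1 ((le_max_left _ _).trans h1.1.le)
    have hd : ∀ᵐ s ∂(volume.restrict (Icc (0 : ℝ) 1)), deriv V s = 0 := by
      have h2 := h1.2
      rw [intervalIntegral_eq_integral_Icc,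
        Real.sqrt_eq_zero (integral_nonneg fun _ => by positivity),
        integral_eq_zero_iff_of_nonneg (fun _ => by positivity) hV.1.2.integrable_norm_sq] at h2
      filter_upwards [h2] with s hs
      simpa using hs
    have hI : ∫ s in Icc (0 : ℝ) 1, ‖deriv V s‖ ^ 2 = 0 := by
      rw [integral_congr_ae (g := fun _ => (0 : ℝ)) (by
        filter_upwards [hd] with s hs; simp [hs])]
      simp
    have hVs : ∀ s ∈ Icc (0 : ℝ) 1, V s = 0 := by
      intro s hs
      refine norm_le_zero_iff.1 (le_of_forall_pos_le_add fun l hl => ?_)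
      have h3 := hV.1.norm_sub_le (s := 0) (t := s) (by simp) hs hl
      rw [hI, hV0, sub_zero, sub_zero, mul_zero, abs_of_nonneg hs.1] at h3
      nlinarith [hs.2]
    rw [← h0, mul_zero, energyDifferential, intervalIntegral_eq_integral_Icc,
      integral_congr_ae (g := fun _ => (0 : ℝ))]
    · simp
    · filter_upwards [hd, ae_restrict_mem measurableSet_Icc] with s hs hs1
      rw [hs, hVs s hs1]
      exact map_zero _
  · set a := (starNorm V)⁻¹ with ha
    have ha0 : 0 < a := inv_pos.2 hpos
    have hder : ∀ s, deriv (fun s => a • V s) s = a • deriv V s :=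
      fun s => deriv_fun_const_smul_field a V
    have hmem : (fun s => a • V s) ∈ admissibleVariations M Φ x := by
      refine ⟨⟨hV.1.1.const_smul a, ?_⟩, fun s hs => smul_mem_tangentSpace a (hV.2.1 s hs), ?_, ?_, ?_⟩
      · rw [funext hder]
        exact hV.1.2.const_smul a
      · rw [hdΦ, hV.2.2.1, mul_zero]
      · rw [hdΦ, hV.2.2.2.1, mul_zero]
      · intro s hs hxs
        rw [hdΦ]
        exact mul_nonpos_of_nonneg_of_nonpos ha0.le (hV.2.2.2.2 s hs hxs)
    have hnorm : starNorm (fun s => a • V s) = 1 := by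
      have : starNorm (fun s => a • V s) = a * starNorm V := by
        simp only [starNorm, hder, norm_smul, Real.norm_of_nonneg ha0.le, mul_pow]
        rw [intervalIntegral.integral_const_mul, Real.sqrt_mul (sq_nonneg _),
          Real.sqrt_sq ha0.le, ← mul_max_of_nonneg _ _ ha0.le, mul_add]
      rw [this, ha, inv_mul_cancel₀ hpos.ne']
    have hE : energyDifferential M F x (fun s => a • V s) = a * energyDifferential M F x V := by
      have h2 : ∀ s, ((a • V s, a • deriv V s) : E × E) = a • (V s, deriv V s) := fun s => rfl
      simp only [energyDifferential, hder, h2, hdiff]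
      rw [intervalIntegral.integral_const_mul]
      ring
    have h3 := h _ hmem hnorm
    rw [hE, ha, inv_mul_eq_div, le_div_iff₀ hpos] at h3
    exact h3

end PalaisSmale

/-! ### Strong convergence of a subsequence -/

section Compactness

variable {E : Type*} [NormedAddCommGroup E] [NormedSpace ℝ E] [FiniteDimensional ℝ E]
  {M : Set E} {F : E × E → ℝ} {Φ : E → ℝ}

/-- `H¹`-bounded sequences with values in a compact set have uniformly convergent subsequences. -/
theorem exists_subseq_tendstoUniformly {K : Set E} (hK : IsCompact K) {x : ℕ → ℝ → E}
    (hx : ∀ n, IsH1 (x n)) (hxK : ∀ n, ∀ s ∈ Icc (0 : ℝ) 1, x n s ∈ K) {B : ℝ}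
    (hB : ∀ n, ∫ s in Icc (0 : ℝ) 1, ‖deriv (x n) s‖ ^ 2 ≤ B) :
    ∃ (y : ℝ → E) (φ : ℕ → ℕ), StrictMono φ ∧
      ∀ ε > 0, ∀ᶠ n in atTop, ∀ s ∈ Icc (0 : ℝ) 1, dist (x (φ n) s) (y s) < ε := by
  have hcont : ∀ n, Continuous fun s : Icc (0 : ℝ) 1 => x n s := fun n => by
    have := (hx n).1.continuousOn
    rw [uIcc_of_le zero_le_one] at this
    exact this.domRestrict
  let f : ℕ → BoundedContinuousFunction (Icc (0 : ℝ) 1) E := fun n =>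
    BoundedContinuousFunction.mkOfCompact ⟨_, hcont n⟩
  have hf : ∀ n s, f n s = x n s := fun n s => rfl
  have hB0 : 0 ≤ B := (integral_nonneg fun _ => by positivity).trans (hB 0)
  have hcomp : IsCompact (closure (range f)) := by
    refine BoundedContinuousFunction.arzela_ascoli K hK _ ?_ ?_
    · rintro _ s ⟨n, rfl⟩
      exact hxK n s s.2
    · intro s
      rw [Metric.equicontinuousAt_iff]
      intro ε hε
      -- Chosen so that l⁻¹B ≤ ε/2; the 1 keeps l positive when B = 0.
      set l := (2 * B + 1) / ε with hl
      have hl0 : 0 < l := by positivity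
      refine ⟨ε / (2 * l), by positivity, fun t ht => ?_⟩
      rintro ⟨_, n, rfl⟩
      change dist (x n s) (x n t) < ε
      have h1 := (hx n).norm_sub_le t.2 s.2 hl0
      have h2 : l * |(s : ℝ) - t| < ε / 2 := by
        have h3 : |(s : ℝ) - t| < ε / (2 * l) := by
          rw [abs_sub_comm]; simpa [Subtype.dist_eq, Real.dist_eq] using ht
        calc l * |(s : ℝ) - t| < l * (ε / (2 * l)) := by gcongr
          _ = ε / 2 := by field_simp
      have h4 : l⁻¹ * ∫ v in Icc (0 : ℝ) 1, ‖deriv (x n) v‖ ^ 2 ≤ ε / 2 := by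
        calc l⁻¹ * ∫ v in Icc (0 : ℝ) 1, ‖deriv (x n) v‖ ^ 2 ≤ l⁻¹ * B := by
              gcongr
              exact hB n
          _ = ε * B / (2 * B + 1) := by rw [hl]; field_simp
          _ ≤ ε / 2 := by
              rw [div_le_div_iff₀ (by positivity) two_pos]
              linarith
      rw [dist_eq_norm]
      linarith
  obtain ⟨g, -, φ, hφ, hg⟩ := hcomp.tendsto_subseq fun n => subset_closure (mem_range_self n)
  refine ⟨fun s => g (projIcc 0 1 zero_le_one s), φ, hφ, fun ε hε => ?_⟩
  filter_upwards [Metric.tendsto_nhds.1 hg ε hε] with n hn s hs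
  have := (BoundedContinuousFunction.dist_coe_le_dist (f := f (φ n)) (g := g) ⟨s, hs⟩).trans_lt hn
  rw [projIcc_of_mem _ hs]
  exact this

/-- The derivatives of a uniformly Cauchy Palais-Smale sequence form a Cauchy sequence in `L²`. -/
theorem cauchy_deriv_of_palaisSmale (hF : IsFinslerMetric M F) (hM : HasLocalRetractions M)
    (hK : IsCompact (closedDomain M Φ)) {A : E × E → E}
    (hA : IsAdmissibleField M Φ (closedDomain M Φ) A) {x : ℕ → ℝ → E} {B : ℝ} {ε : ℕ → ℝ}
    (hx : ∀ n, x n ∈ curveSpace M Φ)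
    (hB : ∀ n, ∫ s in Icc (0 : ℝ) 1, ‖deriv (x n) s‖ ^ 2 ≤ B)
    (hε0 : ∀ n, 0 ≤ ε n) (hε : Tendsto ε atTop (𝓝 0))
    (hPS : ∀ n, ∀ V ∈ admissibleVariations M Φ (x n), starNorm V = 1 →
      -ε n ≤ energyDifferential M F (x n) V)
    (hu : ∀ δ > 0, ∃ N, ∀ n ≥ N, ∀ m ≥ N, ∀ s ∈ Icc (0 : ℝ) 1, dist (x n s) (x m s) < δ) :
    ∀ η > 0, ∃ N, ∀ n ≥ N, ∀ m ≥ N,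
      ∫ s in Icc (0 : ℝ) 1, ‖deriv (x n) s - deriv (x m) s‖ ^ 2 ≤ η := by
  intro η hη
  have hB0 : 0 ≤ B := (integral_nonneg fun _ => by positivity).trans (hB 0)
  obtain ⟨S, hS⟩ := IsAdmissibleField.exists_starNorm_le hA.contDiff hK B
  have hlow : ∀ n m, -(ε n * S) ≤ energyDifferential M F (x n) fun s => A (x n s, x m s) := by
    intro n m
    refine le_trans ?_ (le_energyDifferential (hPS n)
      (hA.mem_admissibleVariations hK (hx n) (hx m)))
    rw [neg_mul, neg_le_neg_iff]
    exact mul_le_mul_of_nonneg_left (hS _ (hx n) _ (hx m) (hB n) (hB m)) (hε0 n)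
  have hS0 : 0 ≤ S := (add_nonneg (le_max_of_le_left (norm_nonneg _)) (Real.sqrt_nonneg _)).trans
    (hS _ (hx 0) _ (hx 0) (hB 0) (hB 0))
  -- Budget for η: the quadratic error costs at most 2B times this ε, hence η/2, and the two
  -- Palais–Smale terms 2Cε_kS cost at most η/4 each.
  obtain ⟨C, hC, δ, hδ, hcoer⟩ := hF.exists_norm_sub_sq_le hM hK (fun _ h => h.1) hA
    (ε := η / (2 * (2 * B + 1))) (by positivity)
  obtain ⟨N₁, hN₁⟩ := hu δ hδ
  obtain ⟨N₂, hN₂⟩ := eventually_atTop.1 (hε.eventually_lt_const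
    (show 0 < η / (8 * (C * S + 1)) by positivity))
  refine ⟨max N₁ N₂, fun n hn m hm => ?_⟩
  have hin := hA.integrable_energyPairing hF hM hK (hx n) (hx m)
  have him := hA.integrable_energyPairing hF hM hK (hx m) (hx n)
  have hsq := (hx n).1.2.integrable_norm_sq.add (hx m).1.2.integrable_norm_sq
  set a := η / (2 * (2 * B + 1)) with ha
  have ha0 : 0 ≤ a := by positivity
  have h1 : ∫ s in Icc (0 : ℝ) 1, ‖deriv (x n) s - deriv (x m) s‖ ^ 2 ≤
      ∫ s in Icc (0 : ℝ) 1, (a * (‖deriv (x n) s‖ ^ 2 + ‖deriv (x m) s‖ ^ 2) -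
        C * (energyPairing M F A ((x n s, x m s), (deriv (x n) s, deriv (x m) s)) +
          energyPairing M F A ((x m s, x n s), (deriv (x m) s, deriv (x n) s)))) := by
    refine integral_mono_ae ((hx n).1.2.sub (hx m).1.2).integrable_norm_sq
      ((hsq.const_mul a).sub ((hin.add him).const_mul C)) ?_
    filter_upwards [ae_mem_tangentPairs (hx n) (hx m), ae_restrict_mem measurableSet_Icc]
      with s hs hs1
    exact hcoer _ hs (hN₁ n (le_of_max_le_left hn) m (le_of_max_le_left hm) s hs1)
  have h2 : ∫ s in Icc (0 : ℝ) 1, (a * (‖deriv (x n) s‖ ^ 2 + ‖deriv (x m) s‖ ^ 2) -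
        C * (energyPairing M F A ((x n s, x m s), (deriv (x n) s, deriv (x m) s)) +
          energyPairing M F A ((x m s, x n s), (deriv (x m) s, deriv (x n) s)))) =
      a * ((∫ s in Icc (0 : ℝ) 1, ‖deriv (x n) s‖ ^ 2) +
        ∫ s in Icc (0 : ℝ) 1, ‖deriv (x m) s‖ ^ 2) -
      C * (2 * energyDifferential M F (x n) (fun s => A (x n s, x m s)) +
        2 * energyDifferential M F (x m) (fun s => A (x m s, x n s))) := by
    rw [IsAdmissibleField.energyDifferential_eq hA.contDiff (hx n).1 (hx m).1,
      IsAdmissibleField.energyDifferential_eq hA.contDiff (hx m).1 (hx n).1,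
      ← integral_add (hx n).1.2.integrable_norm_sq (hx m).1.2.integrable_norm_sq,
      ← mul_assoc, ← mul_assoc, mul_one_div_cancel two_ne_zero, one_mul, one_mul,
      ← integral_add hin him, ← integral_const_mul, ← integral_const_mul]
    exact integral_sub (hsq.const_mul a) ((hin.add him).const_mul C)
  have h3 : a * ((∫ s in Icc (0 : ℝ) 1, ‖deriv (x n) s‖ ^ 2) +
      ∫ s in Icc (0 : ℝ) 1, ‖deriv (x m) s‖ ^ 2) ≤ η / 2 := by
    calc _ ≤ a * (B + B) := by gcongr; exacts [hB n, hB m]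
      _ ≤ a * (2 * B + 1) := mul_le_mul_of_nonneg_left (by linarith) ha0
      _ = η / 2 := by rw [ha]; field_simp
  have h4 : ∀ k ≥ max N₁ N₂, C * (ε k * S) ≤ η / 8 := fun k hk => by
    calc C * (ε k * S) = ε k * (C * S) := by ring
      _ ≤ η / (8 * (C * S + 1)) * (C * S + 1) := by
          gcongr
          · exact (hN₂ k (le_of_max_le_right hk)).le
          · linarith
      _ = η / 8 := by field_simp
  have h5 := mul_le_mul_of_nonneg_left (hlow n m) hC.le
  have h6 := mul_le_mul_of_nonneg_left (hlow m n) hC.le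
  have h7 := h4 n hn
  have h8 := h4 m hm
  linarith

theorem IsPalaisSmale.exists_tendsto (hF : IsFinslerMetric M F) (hM : HasLocalRetractions M)
    {N : ℕ} (hΦ : IsDiskFunction N M Φ) {c : ℝ} {x : ℕ → ℝ → E} (hx : IsPalaisSmale M F Φ c x) :
    ∃ y ∈ curveSpace M Φ, ∃ φ : ℕ → ℕ, StrictMono φ ∧
      Tendsto (fun n => h1Norm (fun s => x (φ n) s - y s)) atTop (𝓝 0) := by
  have : CompleteSpace E := FiniteDimensional.complete ℝ E
  obtain ⟨hxc, hJ, ε, hε, hPS⟩ := hx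
  have hK := hΦ.isCompact
  obtain ⟨A, hA⟩ := exists_isAdmissibleField hM hΦ
  obtain ⟨m, hm, hmE⟩ := hF.integral_norm_sq_le hM hK
  obtain ⟨J, hJb⟩ := hJ.bddAbove_range
  have hB : ∀ n, ∫ s in Icc (0 : ℝ) 1, ‖deriv (x n) s‖ ^ 2 ≤ 2 * J / m := fun n => by
    rw [le_div_iff₀ hm, mul_comm]
    linarith [hmE _ (hxc n), hJb (mem_range_self n)]
  obtain ⟨z, φ₁, hφ₁, hz⟩ := exists_subseq_tendstoUniformly hK (fun n => (hxc n).1)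
    (fun n => (hxc n).2.1) hB
  obtain ⟨hε0, hεpos⟩ := tendsto_nhdsWithin_iff.1 hε
  obtain ⟨n₀, hn₀⟩ := eventually_atTop.1 hεpos
  -- The shift skips the initial indices at which ε_n need not be positive.
  set φ : ℕ → ℕ := fun n => φ₁ (n + n₀) with hφdef
  have hφ : StrictMono φ := fun a b hab => hφ₁ (Nat.add_lt_add_right hab n₀)
  have hφn : ∀ n, n₀ ≤ φ n := fun n => (Nat.le_add_left n₀ n).trans hφ₁.le_apply
  have hzφ : ∀ δ > 0, ∀ᶠ n in atTop, ∀ s ∈ Icc (0 : ℝ) 1, dist (x (φ n) s) (z s) < δ :=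
    fun δ hδ => (tendsto_add_atTop_nat n₀).eventually (hz δ hδ)
  have hC := cauchy_deriv_of_palaisSmale hF hM hK hA (x := fun n => x (φ n))
    (ε := fun n => ε (φ n)) (fun n => hxc _) (fun n => hB _)
    (fun n => (mem_Ioi.1 (hn₀ _ (hφn n))).le) (hε0.comp hφ.tendsto_atTop) (fun n => hPS _) (by
      intro δ hδ
      obtain ⟨n₁, hn₁⟩ := eventually_atTop.1 (hzφ (δ / 2) (by positivity))
      refine ⟨n₁, fun n hn k hk s hs => ?_⟩
      linarith [dist_triangle_right (x (φ n) s) (x (φ k) s) (z s), hn₁ n hn s hs, hn₁ k hk s hs])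
  obtain ⟨g, hg, hgt⟩ := exists_memLp_tendsto_integral_norm_sub_sq
    (fun n => (hxc (φ n)).1.2) hC
  -- The uniform limit z is not yet known to be H¹; y is rebuilt as the primitive of the L² limit g
  -- and then identified with z on [0,1].
  obtain ⟨hyH, hyd⟩ := isH1_integral hg (z 0)
  set y := fun s => z 0 + ∫ t in (0 : ℝ)..s, g t with hy
  have hd : ∀ n, ∫ s in Icc (0 : ℝ) 1, ‖deriv (fun s => x (φ n) s - y s) s‖ ^ 2 =
      ∫ s in Icc (0 : ℝ) 1, ‖deriv (x (φ n)) s - g s‖ ^ 2 := fun n => by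
    refine integral_congr_ae ?_
    filter_upwards [((hxc (φ n)).1.sub hyH).2, hyd] with s h1 h2
    rw [h1, h2]
  have hlim : ∀ s ∈ Icc (0 : ℝ) 1, Tendsto (fun n => x (φ n) s) atTop (𝓝 (z s)) := fun s hs => by
    refine Metric.tendsto_nhds.2 fun δ hδ => ?_
    filter_upwards [hzφ δ hδ] with n hn using hn s hs
  have hyz : ∀ s ∈ Icc (0 : ℝ) 1, z s = y s := by
    intro s hs
    have h0 : (0 : ℝ) ∈ Icc (0 : ℝ) 1 := by simp
    have h1 : Tendsto (fun n => (x (φ n) s - y s) - (x (φ n) 0 - y 0)) atTop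
        (𝓝 ((z s - y s) - (z 0 - y 0))) :=
      ((hlim s hs).sub_const _).sub ((hlim 0 h0).sub_const _)
    have hy0 : z 0 - y 0 = 0 := by simp [hy]
    rw [hy0, sub_zero] at h1
    -- For fixed l the integral term vanishes as n → ∞, leaving ‖z s - y s‖ ≤ l·s with l > 0
    -- arbitrary.
    refine sub_eq_zero.1 (norm_le_zero_iff.1 (le_of_forall_pos_le_add fun l hl => ?_))
    have h2 : Tendsto (fun n => l * |s - 0| +
        l⁻¹ * ∫ v in Icc (0 : ℝ) 1, ‖deriv (x (φ n)) v - g v‖ ^ 2) atTop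
        (𝓝 (l * |s - 0| + l⁻¹ * 0)) := (hgt.const_mul l⁻¹).const_add _
    have h3 := le_of_tendsto_of_tendsto' h1.norm h2 fun n => by
      have := ((hxc (φ n)).1.sub hyH).1.norm_sub_le h0 hs hl
      rwa [hd n] at this
    rw [sub_zero, mul_zero, abs_of_nonneg hs.1] at h3
    nlinarith [hs.2]
  have hyK : ∀ s ∈ Icc (0 : ℝ) 1, y s ∈ closedDomain M Φ := fun s hs =>
    hK.isClosed.mem_of_tendsto (hyz s hs ▸ hlim s hs)
      (Eventually.of_forall fun n => (hxc (φ n)).2.1 s hs)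
  have hyb : ∀ s ∈ Icc (0 : ℝ) 1, (∀ n, x (φ n) s ∈ boundary M Φ) → y s ∈ boundary M Φ := by
    intro s hs hb
    refine ⟨(hyK s hs).1, ?_⟩
    have h1 : Tendsto (fun n => Φ (x (φ n) s)) atTop (𝓝 (Φ (y s))) :=
      (hΦ.contDiffOn.continuousOn (y s) (hyK s hs).1).tendsto.comp (tendsto_nhdsWithin_iff.2
        ⟨hyz s hs ▸ hlim s hs, Eventually.of_forall fun n => (hb n).1⟩)
    exact tendsto_nhds_unique h1 (by simp [(hb _).2])
  refine ⟨y, ⟨hyH, hyK, hyb 0 (by simp) fun n => (hxc _).2.2.1,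
    hyb 1 (by simp) fun n => (hxc _).2.2.2⟩, φ, hφ, ?_⟩
  have h1 : Tendsto (fun n => ∫ s in (0 : ℝ)..1, ‖x (φ n) s - y s‖ ^ 2) atTop (𝓝 0) := by
    refine Metric.tendsto_nhds.2 fun δ hδ => ?_
    filter_upwards [hzφ √(δ / 2) (by positivity)] with n hn
    have hle : ‖∫ s in (0 : ℝ)..1, ‖x (φ n) s - y s‖ ^ 2‖ ≤ δ / 2 * |1 - 0| := by
      refine intervalIntegral.norm_integral_le_of_norm_le_const fun s hs => ?_
      rw [uIoc_of_le zero_le_one] at hs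
      have hs' : s ∈ Icc (0 : ℝ) 1 := Ioc_subset_Icc_self hs
      have h2 := hn s hs'
      rw [hyz s hs', dist_eq_norm] at h2
      rw [Real.norm_of_nonneg (by positivity), ← Real.sq_sqrt (show 0 ≤ δ / 2 by positivity)]
      gcongr
    rw [dist_zero_right]
    simp only [sub_zero, abs_one, mul_one] at hle
    linarith
  have h2 : Tendsto (fun n => ∫ s in (0 : ℝ)..1, ‖deriv (fun s => x (φ n) s - y s) s‖ ^ 2) atTop
      (𝓝 0) := by
    simp only [intervalIntegral_eq_integral_Icc, hd]
    exact hgt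
  have h3 := (Real.continuous_sqrt.tendsto (0 + 0)).comp (h1.add h2)
  rw [add_zero, Real.sqrt_zero] at h3
  exact h3

end Compactness

end FinslerChord

theorem mainTheorem3 (N : ℕ) (hN : 2 ≤ N)
    (M : Set (EuclideanSpace ℝ (Fin (2 * N)))) (hM : FinslerChord.IsSubmanifold 3 N M)
    (F : EuclideanSpace ℝ (Fin (2 * N)) × EuclideanSpace ℝ (Fin (2 * N)) → ℝ)
    (hF : FinslerChord.IsFinslerMetric M F)
    (Φ : EuclideanSpace ℝ (Fin (2 * N)) → ℝ) (hΦ : FinslerChord.IsDiskFunction N M Φ)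
    (c : ℝ) (x : ℕ → ℝ → EuclideanSpace ℝ (Fin (2 * N)))
    (hx : FinslerChord.IsPalaisSmale M F Φ c x) :
    ∃ y ∈ FinslerChord.curveSpace M Φ, ∃ φ : ℕ → ℕ, StrictMono φ ∧
      Tendsto (fun n => FinslerChord.h1Norm (fun s => x (φ n) s - y s)) atTop (𝓝 0) :=
  hx.exists_tendsto hF hM.hasLocalRetractions hΦ
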